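/- Work over $\mathbb C$. Let $V=\mathbb C^{n+1}$, let $v_d\colon \mathbb PV\to\mathbb P(S^dV)$ be the $d$-th Veronese embedding, and for $Y\subset\mathbb P^N$ let $\sigma_r(Y)$ be the Zariski closure of the union of the linear spans $\langle y_1,\dots,y_r\rangle$ with $y_1,\dots,y_r\in Y$ (so $\sigma_0(Y)=\emptyset$). For a closed subscheme $R\subset\mathbb PV$ with saturated homogeneous ideal $I(R)\subset \operatorname{Sym}(V^*)$, let $\langle v_d(R)\rangle=\mathbb P(I_d(R)^\perp)\subset\mathbb P(S^dV)$ be the linear span of $v_d(R)$. A zero-dimensional subscheme of $\mathbb PV$ of degree $q$ is called smoothable if, in the Hilbert scheme $\mathrm{Hilb}_q(\mathbb PV)$ of zero-dimensional subschemes of degree $q$, it lies in the closure of the locus of $q$-tuples of distinct reduced points. Let $r\ge 1$ be an integer such that the following condition holds: (B) every Gorenstein zero-dimensional subscheme $Q\subset\mathbb PV$ of degree $q<r$ is smoothable. Let $d\ge 2r-1$ and let $p\in\sigma_r(v_d(\mathbb PV))$ with $p\notin\sigma_{r-1}(v_d(\mathbb PV))$. Then there is exactly one zero-dimensional subscheme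 $R\subset\mathbb PV$ of degree $r$ such that $p\in\langle v_d(R)\rangle$. -/

import Mathlib

open scoped LinearAlgebra.Projectivization

noncomputable section

namespace VeroneseSecant

/-- The homogeneous coordinate ring `Sym (V^*) = ℂ[x₀, …, xₙ]` of `ℙ V = ℙⁿ`, `V = ℂ^{n+1}`. -/
abbrev CoordRing (n : ℕ) : Type := MvPolynomial (Fin (n + 1)) ℂ

/-- Closed points of `ℙ V = ℙⁿ`. -/
abbrev PV (n : ℕ) : Type := ℙ ℂ (Fin (n + 1) → ℂ)

/-- Exponents of the monomials of degree `d` in `x₀, …, xₙ`. -/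
abbrev Mon (n d : ℕ) : Type :=
  {m : Fin (n + 1) →₀ ℕ // m ∈ Finset.finsuppAntidiag (Finset.univ : Finset (Fin (n + 1))) d}

/-- `S^d V`, in the coordinates dual to the monomial basis of `S^d V^*`. -/
abbrev SymPow (n d : ℕ) : Type := Mon n d → ℂ

/-- The pairing of `S^d V^*` (forms of degree `d`) with `S^d V`. -/
def pairing {n d : ℕ} (f : CoordRing n) (w : SymPow n d) : ℂ :=
  ∑ m : Mon n d, f.coeff m.1 * w m

/-- The vector of all monomials of degree `d` in the coordinates of `x`; it represents the
`d`-th power of `x` in `S^d V`. -/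
def veroneseVec {n : ℕ} (d : ℕ) (x : Fin (n + 1) → ℂ) : SymPow n d :=
  fun m => ∏ i, x i ^ m.1 i

theorem veroneseVec_ne_zero {n : ℕ} (d : ℕ) {x : Fin (n + 1) → ℂ} (hx : x ≠ 0) :
    veroneseVec d x ≠ 0 := by
  obtain ⟨i, hi⟩ := Function.ne_iff.mp hx
  intro h
  have hm : Finsupp.single i d ∈
      Finset.finsuppAntidiag (Finset.univ : Finset (Fin (n + 1))) d := by
    rw [Finset.mem_finsuppAntidiag]
    refine ⟨?_, Finset.subset_univ _⟩
    simp [Finsupp.single_apply]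
  have h0 := congrFun h ⟨_, hm⟩
  simp only [veroneseVec, Pi.zero_apply] at h0
  obtain ⟨j, -, hj⟩ := Finset.prod_eq_zero_iff.mp h0
  by_cases hij : i = j
  · subst hij
    simp only [Finsupp.single_eq_same] at hj
    exact hi (eq_zero_of_pow_eq_zero hj)
  · simp [hij] at hj

/-- The `d`-th Veronese embedding `v_d : ℙ V → ℙ (S^d V)`. -/
def veronese {n : ℕ} (d : ℕ) (x : PV n) : ℙ ℂ (SymPow n d) :=
  Projectivization.mk ℂ (veroneseVec d x.rep) (veroneseVec_ne_zero d x.rep_nonzero)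

/-- Zariski closure of a set of points of a projective space with coordinates indexed by `ι`:
the common zeros of all homogeneous polynomials that vanish on the set. -/
def zariskiClosure {ι : Type} (A : Set (ℙ ℂ (ι → ℂ))) : Set (ℙ ℂ (ι → ℂ)) :=
  {p | ∀ (k : ℕ) (F : MvPolynomial ι ℂ), F.IsHomogeneous k →
    (∀ a ∈ A, MvPolynomial.eval a.rep F = 0) → MvPolynomial.eval p.rep F = 0}

/-- The `r`-th secant variety `σ_r(Y)`: the Zariski closure of the union of the linear spans
`⟨y₁, …, y_r⟩` with all `y_i ∈ Y`. -/
def secantVariety {ι : Type} (r : ℕ) (Y : Set (ℙ ℂ (ι → ℂ))) : Set (ℙ ℂ (ι → ℂ)) :=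
  zariskiClosure {p | ∃ y : Fin r → ℙ ℂ (ι → ℂ),
    (∀ i, y i ∈ Y) ∧ p ∈ Projectivization.Subspace.span (Set.range y)}

/-- A closed subscheme of `ℙⁿ`, given by its homogeneous ideal `I(X)`, saturated with respect
to the irrelevant ideal `(x₀, …, xₙ)`. -/
@[ext]
structure ProjSubscheme (n : ℕ) where
  ideal : Ideal (CoordRing n)
  homogeneous : ∀ f ∈ ideal, ∀ k : ℕ, MvPolynomial.homogeneousComponent k f ∈ ideal
  saturated : ∀ f : CoordRing n,
    (∃ k : ℕ, ∀ i, (MvPolynomial.X i : CoordRing n) ^ k * f ∈ ideal) → f ∈ ideal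

namespace ProjSubscheme

variable {n : ℕ}

/-- The value at `D` of the Hilbert function: the dimension of `(Sym V^* / I(X))_D`. -/
def hilbertFunction (X : ProjSubscheme n) (D : ℕ) : ℕ :=
  Module.finrank ℂ (↥(MvPolynomial.homogeneousSubmodule (Fin (n + 1)) ℂ D) ⧸
    (X.ideal.restrictScalars ℂ).comap
      (MvPolynomial.homogeneousSubmodule (Fin (n + 1)) ℂ D).subtype)

/-- `X` is zero-dimensional of degree `r`: its Hilbert polynomial is the constant `r`.
(For `r = 0` this says that `X` is empty.) -/
def IsZeroDimOfDegree (X : ProjSubscheme n) (r : ℕ) : Prop :=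
  ∀ᶠ D in Filter.atTop, X.hilbertFunction D = r

/-- The linear subspace `I_d(X)^⊥` of `S^d V`. -/
def perp (X : ProjSubscheme n) (d : ℕ) : Submodule ℂ (SymPow n d) where
  carrier := {w | ∀ f ∈ X.ideal, f.IsHomogeneous d → pairing f w = 0}
  zero_mem' := fun f _ _ => by simp [pairing]
  add_mem' := fun {a b} ha hb f hf hd => by
    have h1 := ha f hf hd
    have h2 := hb f hf hd
    simp only [pairing] at h1 h2 ⊢
    simp only [Pi.add_apply, mul_add, Finset.sum_add_distrib, h1, h2, add_zero]
  smul_mem' := fun c a ha f hf hd => by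
    have h1 := ha f hf hd
    simp only [pairing] at h1 ⊢
    have : ∀ m : Mon n d, f.coeff m.1 * (c • a) m = c * (f.coeff m.1 * a m) := fun m => by
      simp only [Pi.smul_apply, smul_eq_mul]; ring
    rw [Finset.sum_congr rfl fun m _ => this m, ← Finset.mul_sum, h1, mul_zero]

/-- The linear span `⟨v_d(X)⟩ = ℙ (I_d(X)^⊥) ⊆ ℙ (S^d V)`: the linear forms on `ℙ (S^d V)` that
vanish on the scheme `v_d(X)` are the elements of `I_d(X)`. -/
def veroneseSpan (X : ProjSubscheme n) (d : ℕ) :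
    Projectivization.Subspace ℂ (SymPow n d) :=
  (X.perp d).projectivization

/-- The coordinate ring of the affine scheme `X ∩ {x_i ≠ 0}`. -/
abbrev ChartRing (X : ProjSubscheme n) (i : Fin (n + 1)) : Type :=
  CoordRing n ⧸ (X.ideal ⊔ Ideal.span {(MvPolynomial.X i : CoordRing n) - 1})

/-- A zero-dimensional scheme is Gorenstein if the socle (the annihilator of the maximal ideal) of
each of its local rings is one-dimensional over `ℂ`. The local rings of `X` are those of its
affine charts at their maximal ideals. -/
def IsGorenstein (X : ProjSubscheme n) : Prop :=
  ∀ (i : Fin (n + 1)) (m : Ideal (X.ChartRing i)) [m.IsMaximal],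
    Module.finrank ℂ
      ↥(Submodule.annihilator (IsLocalRing.maximalIdeal (Localization.AtPrime m))) = 1

end ProjSubscheme

/-- The Zariski topology on the affine space with coordinates indexed by `κ`. -/
abbrev affineZariski (κ : Type) : TopologicalSpace (κ → ℂ) :=
  TopologicalSpace.induced
    (fun x => (MvPolynomial.pointToPoint x : PrimeSpectrum (MvPolynomial κ ℂ))) inferInstance

/-- The `r`-frames of `ℂ^ι`: linearly independent `r`-tuples of vectors. -/
abbrev Frame (r : ℕ) (ι : Type) : Type := {w : Fin r → ι → ℂ // LinearIndependent ℂ w}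

/-- The Zariski topology on the frames, an open subset of the affine space of `r × ι` matrices. -/
abbrev frameZariski (r : ℕ) (ι : Type) : TopologicalSpace (Frame r ι) :=
  TopologicalSpace.induced (fun w (a : Fin r × ι) => w.1 a.1 a.2) (affineZariski (Fin r × ι))

/-- The Zariski topology of the Grassmannian of `r`-dimensional subspaces of `ℂ^ι`, which is the
quotient of the variety of `r`-frames by `GL_r`. (Only its restriction to the set of
`r`-dimensional subspaces is meaningful.) -/
abbrev grassmannianZariski (r : ℕ) (ι : Type) : TopologicalSpace (Submodule ℂ (ι → ℂ)) :=
  TopologicalSpace.coinduced (fun w : Frame r ι => Submodule.span ℂ (Set.range w.1))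
    (frameZariski r ι)

/-- The points of the Hilbert scheme `Hilb_r(ℙⁿ)`: the zero-dimensional subschemes of `ℙⁿ` of
degree `r`. -/
def Hilb (n r : ℕ) : Type := {X : ProjSubscheme n // X.IsZeroDimOfDegree r}

/-- The Zariski topology on `Hilb_r(ℙⁿ)`. For `D ≥ r` (the Gotzmann number of the constant Hilbert
polynomial `r`), `X ↦ I_D(X)^⊥` is a closed embedding of `Hilb_r(ℙⁿ)` into the Grassmannian of
`r`-dimensional subspaces of `S^D V`, so that each such `D` induces this topology. -/
instance Hilb.zariski (n r : ℕ) : TopologicalSpace (Hilb n r) :=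
  ⨅ D : {D : ℕ // r ≤ D},
    TopologicalSpace.induced (fun X : Hilb n r => X.1.perp D.1)
      (grassmannianZariski r (Mon n D.1))

/-- `X` consists of `r` distinct (reduced) points. -/
def Hilb.IsDistinctPoints {n r : ℕ} (X : Hilb n r) : Prop :=
  ∃ x : Fin r → PV n, Function.Injective x ∧
    ∀ (k : ℕ) (f : CoordRing n), f.IsHomogeneous k →
      (f ∈ X.1.ideal ↔ ∀ i, MvPolynomial.eval (x i).rep f = 0)

/-- `X` is smoothable in `ℙⁿ`: it lies in the smoothable component of `Hilb_r(ℙⁿ)`, the closure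
of the (open) locus of `r`-tuples of distinct points. -/
def Hilb.IsSmoothable {n r : ℕ} (X : Hilb n r) : Prop :=
  X ∈ closure {Z : Hilb n r | Z.IsDistinctPoints}

/-- Condition (B) for `ℙⁿ` and `r`: all Gorenstein zero-dimensional subschemes of `ℙⁿ` of degree
`q < r` are smoothable in `ℙⁿ`. -/
def ConditionB (n r : ℕ) : Prop :=
  ∀ q < r, ∀ Q : Hilb n q, Q.1.IsGorenstein → Q.IsSmoothable

end VeroneseSecant

end

/-! Everything rests on one fact: the Hilbert function of a saturated homogeneous ideal over an
infinite field increases strictly until it becomes constant, so a scheme of degree `s` imposes `s`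
independent conditions on forms of each degree `D ≥ s - 1` (`hilb_eq_of_eventually_eq`).

Existence. The point `p` is a specialization of a generic linear combination of `r` Veronese
vectors. The specialization extends to a valuation ring with residue field `ℂ`
(`exists_valuationRing_extension`). Reducing the ideal of the `r` generic points along it keeps the
Hilbert function (`hilb_reduction`), and saturating gives a limit scheme of degree `s ≤ r` whose
span contains `p` (`exists_mem_perp_of_mem_secantVariety`).

Degree less than `r` is impossible. Among all schemes whose span contains `p`, one of least degree
is Gorenstein: a socle element orthogonal to `p` could be added to the ideal, giving a smaller
scheme, so the functional `p` is injective on each socle (`isGorenstein_of_minimal`). If the least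
degree is below `r`, condition (B) makes that scheme smoothable. Vanishing of a polynomial on the
span is a closed condition on the Hilbert scheme, so `p` lies in `σ_{r-1}`
(`mem_secantVariety_of_lt`).

Uniqueness. The union of two schemes of degree `r` has degree `e ≤ 2r ≤ d + 1`, hence imposes
independent conditions in degree `d`. The two spans therefore meet in the span of the intersection,
of degree `2r - e < r`, which was just excluded (`exists_lt_of_mem_perp_of_ne`). -/

noncomputable section

namespace VeroneseSecant

open MvPolynomial
open scoped Topology

/-! ### Hilbert functions of saturated ideals, and saturation. -/

section HilbertFunction

variable {σ k : Type*} [Field k]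

/-- The ideal is homogeneous for the standard grading. -/
def IsHomogeneousIdeal (I : Ideal (MvPolynomial σ k)) : Prop :=
  ∀ f ∈ I, ∀ D : ℕ, homogeneousComponent D f ∈ I

/-- The ideal is saturated with respect to the ideal generated by the variables. -/
def IsSaturatedIdeal (I : Ideal (MvPolynomial σ k)) : Prop :=
  ∀ f, (∃ N : ℕ, ∀ i, X i ^ N * f ∈ I) → f ∈ I

/-- The forms of degree `D` in the ideal `I`. -/
def gradedPart (I : Ideal (MvPolynomial σ k)) (D : ℕ) :
    Submodule k (homogeneousSubmodule σ k D) :=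
  (I.restrictScalars k).comap (homogeneousSubmodule σ k D).subtype

/-- The Hilbert function of `k[σ] / I`. -/
def hilb (I : Ideal (MvPolynomial σ k)) (D : ℕ) : ℕ :=
  Module.finrank k (homogeneousSubmodule σ k D ⧸ gradedPart I D)

theorem mem_gradedPart {I : Ideal (MvPolynomial σ k)} {D : ℕ}
    {f : homogeneousSubmodule σ k D} : f ∈ gradedPart I D ↔ (f : MvPolynomial σ k) ∈ I :=
  Iff.rfl

instance finiteDimensional_homogeneousSubmodule [Finite σ] (D : ℕ) :
    FiniteDimensional k (homogeneousSubmodule σ k D) :=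
  Module.Finite.iff_fg.mpr (homogeneousSubmodule_fg σ k D)

theorem hilb_add_finrank [Finite σ] (I : Ideal (MvPolynomial σ k)) (D : ℕ) :
    hilb I D + Module.finrank k (gradedPart I D) =
      Module.finrank k (homogeneousSubmodule σ k D) :=
  Submodule.finrank_quotient_add_finrank _

theorem gradedPart_mono {I J : Ideal (MvPolynomial σ k)} (h : I ≤ J) (D : ℕ) :
    gradedPart I D ≤ gradedPart J D := fun _ hf => h hf

theorem hilb_anti [Finite σ] {I J : Ideal (MvPolynomial σ k)} (h : I ≤ J) (D : ℕ) :
    hilb J D ≤ hilb I D := by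
  have h1 := hilb_add_finrank I D
  have h2 := hilb_add_finrank J D
  have h3 := Submodule.finrank_mono (gradedPart_mono h D)
  omega

theorem mem_of_hilb_eq [Finite σ] {I J : Ideal (MvPolynomial σ k)} (h : I ≤ J) {D : ℕ}
    (hD : hilb I D = hilb J D) {f : MvPolynomial σ k} (hf : f ∈ J) (hfD : f.IsHomogeneous D) :
    f ∈ I := by
  have h1 := hilb_add_finrank I D
  have h2 := hilb_add_finrank J D
  have h3 := Submodule.eq_of_le_of_finrank_eq (gradedPart_mono h D) (by omega)
  have : (⟨f, hfD⟩ : homogeneousSubmodule σ k D) ∈ gradedPart I D := by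
    rw [h3]; exact hf
  exact this

theorem hilb_congr {I J : Ideal (MvPolynomial σ k)} {D : ℕ}
    (h : ∀ f : MvPolynomial σ k, f.IsHomogeneous D → (f ∈ I ↔ f ∈ J)) : hilb I D = hilb J D := by
  have : gradedPart I D = gradedPart J D := by
    ext f
    exact h f.1 f.2
  rw [hilb, hilb, this]

/-- The dimension formula for two subspaces of the forms of degree `D`. Homogeneity allows a form in
the sum to be split into summands of its own degree. -/
theorem hilb_sup_add_hilb_inf [Finite σ] {I J : Ideal (MvPolynomial σ k)} (hI : IsHomogeneousIdeal I)
    (hJ : IsHomogeneousIdeal J) (D : ℕ) :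
    hilb (I ⊔ J) D + hilb (I ⊓ J) D = hilb I D + hilb J D := by
  have hs : gradedPart (I ⊔ J) D = gradedPart I D ⊔ gradedPart J D := by
    apply le_antisymm
    · rintro ⟨f, hfD⟩ hf
      obtain ⟨a, ha, b, hb, hab⟩ := Submodule.mem_sup.mp (mem_gradedPart.mp hf)
      refine Submodule.mem_sup.mpr
        ⟨⟨homogeneousComponent D a, homogeneousComponent_isHomogeneous D a⟩, hI a ha D,
         ⟨homogeneousComponent D b, homogeneousComponent_isHomogeneous D b⟩, hJ b hb D, ?_⟩
      apply Subtype.ext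
      change homogeneousComponent D a + homogeneousComponent D b = f
      rw [← map_add, hab]
      exact homogeneousComponent_eq_self hfD
    · exact sup_le (gradedPart_mono le_sup_left D) (gradedPart_mono le_sup_right D)
  have hi : gradedPart (I ⊓ J) D = gradedPart I D ⊓ gradedPart J D := rfl
  have h1 := hilb_add_finrank I D
  have h2 := hilb_add_finrank J D
  have h3 := hilb_add_finrank (I ⊔ J) D
  have h4 := hilb_add_finrank (I ⊓ J) D
  have h5 := Submodule.finrank_sup_add_finrank_inf_eq (gradedPart I D) (gradedPart J D)
  rw [hs] at h3
  rw [hi] at h4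
  omega

/-- Prime avoidance with linear forms: zero divisors modulo `I` fill finitely many associated
primes, none of which contains all variables, and over an infinite field finitely many proper
subspaces do not cover the linear forms. -/
theorem exists_linearForm_regular [Finite σ] [Infinite k] {I : Ideal (MvPolynomial σ k)}
    (hI : IsSaturatedIdeal I) :
    ∃ l : MvPolynomial σ k, l.IsHomogeneous 1 ∧ ∀ f, l * f ∈ I → f ∈ I := by
  classical
  let S := MvPolynomial σ k
  let A := associatedPrimes S (S ⧸ I)
  have hA : A.Finite := associatedPrimes.finite S (S ⧸ I)
  let V (P : Ideal S) : Submodule k (homogeneousSubmodule σ k 1) := gradedPart P 1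
  have hne : ⊤ ∉ (hA.toFinset.image V) := by
    intro h
    obtain ⟨P, hP, hPV⟩ := Finset.mem_image.mp h
    obtain ⟨hPp, x, hx⟩ := Submodule.isAssociatedPrime_iff.mp
      (hA.mem_toFinset.mp hP : IsAssociatedPrime P (S ⧸ I))
    obtain ⟨f, rfl⟩ := Ideal.Quotient.mk_surjective x
    have hXi : ∀ i, (X i : S) ∈ P := fun i => by
      have : (⟨X i, isHomogeneous_X k i⟩ : homogeneousSubmodule σ k 1) ∈ V P := by
        rw [hPV]; trivial
      exact this
    -- The prime `P` is the annihilator of the class of `f`. If it contains every variable,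
    -- saturation puts `f` in `I`, so `1 ∈ P`.
    refine hPp.ne_top ((Ideal.eq_top_iff_one _).mpr ?_)
    rw [hx, Submodule.mem_colon_singleton, one_smul, Submodule.mem_bot,
      Ideal.Quotient.eq_zero_iff_mem]
    refine hI f ⟨1, fun i => ?_⟩
    have := hXi i
    rw [hx, Submodule.mem_colon_singleton, Submodule.mem_bot] at this
    rw [pow_one]
    exact Ideal.Quotient.eq_zero_iff_mem.mp this
  have hcov := Subspace.biUnion_ne_univ_of_top_notMem (s := hA.toFinset.image V) hne
  obtain ⟨l, hl⟩ := (Set.ne_univ_iff_exists_notMem _).mp hcov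
  refine ⟨l.1, l.2, fun f hf => ?_⟩
  by_contra hfI
  have hz : l.1 ∈ ⋃ P ∈ associatedPrimes S (S ⧸ I), (P : Set S) := by
    rw [biUnion_associatedPrimes_eq_zero_divisors]
    refine ⟨Ideal.Quotient.mk I f, ?_, ?_⟩
    · rwa [Ne, Ideal.Quotient.eq_zero_iff_mem]
    · rw [← Ideal.Quotient.eq_zero_iff_mem] at hf
      exact hf
  apply hl
  simp only [Set.mem_iUnion] at hz ⊢
  obtain ⟨P, hP, hlP⟩ := hz
  exact ⟨V P, Finset.mem_image_of_mem V (hA.mem_toFinset.mpr hP), hlP⟩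

theorem mul_mem_homogeneousSubmodule_succ {l f : MvPolynomial σ k} {D : ℕ}
    (hl : l.IsHomogeneous 1) (hf : f.IsHomogeneous D) : (l * f).IsHomogeneous (D + 1) := by
  rw [add_comm]; exact hl.mul hf

/-- Multiplication by a linear form. -/
def mulLinear (l : MvPolynomial σ k) (hl : l.IsHomogeneous 1) (D : ℕ) :
    homogeneousSubmodule σ k D →ₗ[k] homogeneousSubmodule σ k (D + 1) :=
  (LinearMap.mulLeft k l).restrict fun _ hf => mul_mem_homogeneousSubmodule_succ hl hf

theorem gradedPart_le_comap_mulLinear (I : Ideal (MvPolynomial σ k)) (l : MvPolynomial σ k)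
    (hl : l.IsHomogeneous 1) (D : ℕ) :
    gradedPart I D ≤ (gradedPart I (D + 1)).comap (mulLinear l hl D) :=
  fun _ hf => I.mul_mem_left l hf

/-- Multiplication by a linear form on the homogeneous coordinate ring. -/
def mulLinearQuot (I : Ideal (MvPolynomial σ k)) (l : MvPolynomial σ k) (hl : l.IsHomogeneous 1)
    (D : ℕ) : (homogeneousSubmodule σ k D ⧸ gradedPart I D) →ₗ[k]
      (homogeneousSubmodule σ k (D + 1) ⧸ gradedPart I (D + 1)) :=
  Submodule.mapQ _ _ (mulLinear l hl D) (gradedPart_le_comap_mulLinear I l hl D)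

theorem mulLinearQuot_injective {I : Ideal (MvPolynomial σ k)} {l : MvPolynomial σ k}
    (hl : l.IsHomogeneous 1) (h : ∀ f, l * f ∈ I → f ∈ I) (D : ℕ) :
    Function.Injective (mulLinearQuot I l hl D) := by
  rw [injective_iff_map_eq_zero]
  intro x hx
  obtain ⟨f, rfl⟩ := Submodule.mkQ_surjective _ x
  rw [Submodule.mkQ_apply, mulLinearQuot, Submodule.mapQ_apply,
    Submodule.Quotient.mk_eq_zero] at hx
  rw [Submodule.mkQ_apply, Submodule.Quotient.mk_eq_zero]
  exact h _ hx

theorem hilb_le_succ [Finite σ] [Infinite k] {I : Ideal (MvPolynomial σ k)} (hI : IsSaturatedIdeal I)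
    (D : ℕ) : hilb I D ≤ hilb I (D + 1) := by
  obtain ⟨l, hl, h⟩ := exists_linearForm_regular hI
  exact LinearMap.finrank_le_finrank_of_injective (mulLinearQuot_injective hl h D)

theorem hilb_monotone [Finite σ] [Infinite k] {I : Ideal (MvPolynomial σ k)} (hI : IsSaturatedIdeal I) :
    Monotone (hilb I) := monotone_nat_of_le_succ (hilb_le_succ hI)

/-- If the Hilbert function does not grow, a regular linear form divides all forms of the next
degree modulo `I`. -/
theorem exists_mul_sub_mem_of_hilb_eq [Finite σ] {I : Ideal (MvPolynomial σ k)}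
    {l : MvPolynomial σ k} (hl : l.IsHomogeneous 1) (h : ∀ f, l * f ∈ I → f ∈ I) {D : ℕ}
    (hD : hilb I D = hilb I (D + 1)) {f : MvPolynomial σ k} (hf : f.IsHomogeneous (D + 1)) :
    ∃ g : MvPolynomial σ k, g.IsHomogeneous D ∧ f - l * g ∈ I := by
  have hs : Function.Surjective (mulLinearQuot I l hl D) :=
    (LinearMap.injective_iff_surjective_of_finrank_eq_finrank hD).mp
      (mulLinearQuot_injective hl h D)
  obtain ⟨x, hx⟩ := hs (Submodule.Quotient.mk ⟨f, hf⟩)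
  obtain ⟨g, rfl⟩ := Submodule.mkQ_surjective _ x
  rw [Submodule.mkQ_apply, mulLinearQuot, Submodule.mapQ_apply, eq_comm,
    Submodule.Quotient.eq] at hx
  exact ⟨g.1, g.2, hx⟩

theorem hilb_succ_le_of_forall [Finite σ] {I : Ideal (MvPolynomial σ k)}
    {l : MvPolynomial σ k} (hl : l.IsHomogeneous 1) {D : ℕ}
    (h : ∀ f : MvPolynomial σ k, f.IsHomogeneous (D + 1) →
      ∃ g : MvPolynomial σ k, g.IsHomogeneous D ∧ f - l * g ∈ I) :
    hilb I (D + 1) ≤ hilb I D := by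
  refine LinearMap.finrank_le_finrank_of_surjective (f := mulLinearQuot I l hl D) fun x => ?_
  obtain ⟨f, rfl⟩ := Submodule.mkQ_surjective _ x
  obtain ⟨g, hg, hfg⟩ := h f.1 f.2
  refine ⟨Submodule.Quotient.mk ⟨g, hg⟩, ?_⟩
  rw [Submodule.mkQ_apply, mulLinearQuot, Submodule.mapQ_apply, eq_comm, Submodule.Quotient.eq]
  exact hfg

theorem homogeneousSubmodule_mul_mem {f : MvPolynomial σ k} {D : ℕ}
    (hf : f ∈ homogeneousSubmodule σ k 1 * homogeneousSubmodule σ k D) :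
    f.IsHomogeneous (D + 1) := by
  rw [add_comm]
  exact homogeneousSubmodule_mul 1 D hf

theorem exists_eq_sum_X_mul [Fintype σ] {f : MvPolynomial σ k} {D : ℕ}
    (hf : f.IsHomogeneous (D + 1)) :
    ∃ g : σ → MvPolynomial σ k, (∀ i, (g i).IsHomogeneous D) ∧ f = ∑ i, X i * g i := by
  have hf' : f ∈ homogeneousSubmodule σ k 1 * homogeneousSubmodule σ k D := by
    rw [← homogeneousSubmodule_one_pow k D, ← pow_succ', homogeneousSubmodule_one_pow]
    exact hf
  induction hf' using Submodule.mul_induction_on' with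
  | mem_mul_mem m hm g hg =>
    rw [homogeneousSubmodule_one_eq_span_X] at hm
    obtain ⟨c, rfl⟩ := (Submodule.mem_span_range_iff_exists_fun k).mp hm
    refine ⟨fun i => C (c i) * g, fun i => IsHomogeneous.C_mul hg _, ?_⟩
    rw [Finset.sum_mul]
    refine Finset.sum_congr rfl fun i _ => ?_
    rw [smul_eq_C_mul]
    ring
  | add a ha b hb iha ihb =>
    obtain ⟨g, hg, h1⟩ := iha (homogeneousSubmodule_mul_mem ha)
    obtain ⟨g', hg', h2⟩ := ihb (homogeneousSubmodule_mul_mem hb)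
    refine ⟨fun i => g i + g' i, fun i => (hg i).add (hg' i), ?_⟩
    rw [h1, h2, ← Finset.sum_add_distrib]
    exact Finset.sum_congr rfl fun i _ => by ring

/-- Stagnation propagates: a form of degree `D + 2` is `∑ X i * g i`, and each `g i` is already
divisible by the regular form `l` modulo `I`. -/
theorem hilb_succ_eq_of_hilb_eq [Finite σ] [Infinite k] {I : Ideal (MvPolynomial σ k)}
    (hI : IsSaturatedIdeal I) {D : ℕ} (hD : hilb I D = hilb I (D + 1)) :
    hilb I (D + 1) = hilb I (D + 1 + 1) := by
  classical
  have := Fintype.ofFinite σ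
  obtain ⟨l, hl, h⟩ := exists_linearForm_regular hI
  refine le_antisymm (hilb_le_succ hI _) (hilb_succ_le_of_forall hl fun f hf => ?_)
  obtain ⟨g, hg, rfl⟩ := exists_eq_sum_X_mul hf
  choose g' hg' hgg' using fun i => exists_mul_sub_mem_of_hilb_eq hl h hD (hg i)
  refine ⟨∑ i, X i * g' i, IsHomogeneous.sum _ _ _ fun i _ =>
    mul_mem_homogeneousSubmodule_succ (isHomogeneous_X k i) (hg' i), ?_⟩
  rw [Finset.mul_sum, ← Finset.sum_sub_distrib]
  refine I.sum_mem fun i _ => ?_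
  have : X i * g i - l * (X i * g' i) = X i * (g i - l * g' i) := by ring
  rw [this]
  exact I.mul_mem_left _ (hgg' i)

theorem hilb_eq_of_hilb_eq [Finite σ] [Infinite k] {I : Ideal (MvPolynomial σ k)}
    (hI : IsSaturatedIdeal I) {D : ℕ} (hD : hilb I D = hilb I (D + 1)) (E : ℕ) (hE : D ≤ E) :
    hilb I E = hilb I D := by
  have key : ∀ j, hilb I (D + j) = hilb I (D + j + 1) := by
    intro j
    induction j with
    | zero => exact hD
    | succ j ih => exact hilb_succ_eq_of_hilb_eq hI ih
  induction E, hE using Nat.le_induction with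
  | base => rfl
  | succ E hE ih =>
    obtain ⟨j, rfl⟩ := Nat.exists_eq_add_of_le hE
    rw [← key j, ih]

/-- The Hilbert function of a saturated ideal of degree `s` is constant from degree `s - 1` on. -/
theorem hilb_eq_of_eventually_eq [Finite σ] [Infinite k] {I : Ideal (MvPolynomial σ k)}
    (hI : IsSaturatedIdeal I) {s : ℕ} (hs : ∀ᶠ D in Filter.atTop, hilb I D = s) {D : ℕ}
    (hD : s ≤ D + 1) : hilb I D = s := by
  obtain ⟨N, hN⟩ := Filter.eventually_atTop.mp hs
  have hle : ∀ D, hilb I D ≤ s := fun D => by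
    rw [← hN (max D N) (le_max_right _ _)]
    exact hilb_monotone hI (le_max_left _ _)
  by_contra hne
  have hlt : hilb I D < s := lt_of_le_of_ne (hle D) hne
  -- A stall at some `j ≤ D` would freeze the function at a value below `s`. With a start of at
  -- least 1, strict growth gives `hilb I D ≥ D + 1 ≥ s`.
  have hstep : ∀ j, j ≤ D → hilb I j < hilb I (j + 1) := by
    intro j hj
    refine lt_of_le_of_ne (hilb_le_succ hI j) fun heq => ?_
    have h1 := hilb_eq_of_hilb_eq hI heq D hj
    have h2 := hilb_eq_of_hilb_eq hI heq (max j N) (le_max_left _ _)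
    rw [hN _ (le_max_right _ _)] at h2
    omega
  have hgrow : ∀ j, j ≤ D → hilb I 0 + j ≤ hilb I j := by
    intro j
    induction j with
    | zero => intro _; simp
    | succ j ih =>
      intro hj
      have h1 := ih (by omega)
      have h2 := hstep j (by omega)
      omega
  -- The value 0 in degree 0 means `1 ∈ I`, which forces `s = 0` and contradicts `hlt`.
  have h0 : hilb I 0 ≠ 0 := by
    intro h0
    have h1 : ∀ f : MvPolynomial σ k, f.IsHomogeneous 0 → f ∈ I := by
      intro f hf
      refine mem_of_hilb_eq (J := ⊤) le_top ?_ trivial hf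
      have := hilb_anti (le_top : I ≤ ⊤) 0
      omega
    have h2 : I = ⊤ := (Ideal.eq_top_iff_one _).mpr (h1 1 (isHomogeneous_one σ k))
    subst h2
    have h3 := hN N le_rfl
    have h4 : hilb (⊤ : Ideal (MvPolynomial σ k)) N = 0 := by
      have : gradedPart (⊤ : Ideal (MvPolynomial σ k)) N = ⊤ := rfl
      have h5 := hilb_add_finrank (⊤ : Ideal (MvPolynomial σ k)) N
      rw [this, finrank_top] at h5
      omega
    omega
  have := hgrow D le_rfl
  omega

theorem exists_hilb_eq_of_le [Finite σ] [Infinite k] {I : Ideal (MvPolynomial σ k)}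
    (hI : IsSaturatedIdeal I) {r : ℕ} (hr : ∀ D, hilb I D ≤ r) :
    ∃ s ≤ r, ∀ᶠ D in Filter.atTop, hilb I D = s := by
  have hbdd : BddAbove (Set.range (hilb I)) := ⟨r, by rintro _ ⟨D, rfl⟩; exact hr D⟩
  obtain ⟨N, hN⟩ := Nat.sSup_mem (Set.range_nonempty (hilb I)) hbdd
  refine ⟨hilb I N, hr N, Filter.eventually_atTop.mpr ⟨N, fun D hD => ?_⟩⟩
  refine le_antisymm ?_ (hilb_monotone hI hD)
  rw [hN]
  exact le_csSup hbdd ⟨D, rfl⟩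

/-- The saturation of an ideal. -/
def saturation (I : Ideal (MvPolynomial σ k)) : Ideal (MvPolynomial σ k) where
  carrier := {f | ∃ N : ℕ, ∀ i, X i ^ N * f ∈ I}
  zero_mem' := ⟨0, fun i => by simp⟩
  add_mem' := by
    rintro f g ⟨N, hN⟩ ⟨M, hM⟩
    refine ⟨N + M, fun i => ?_⟩
    have : X i ^ (N + M) * (f + g) = X i ^ M * (X i ^ N * f) + X i ^ N * (X i ^ M * g) := by
      ring
    rw [this]
    exact I.add_mem (I.mul_mem_left _ (hN i)) (I.mul_mem_left _ (hM i))
  smul_mem' := by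
    rintro c f ⟨N, hN⟩
    refine ⟨N, fun i => ?_⟩
    rw [smul_eq_mul, mul_left_comm]
    exact I.mul_mem_left _ (hN i)

theorem le_saturation (I : Ideal (MvPolynomial σ k)) : I ≤ saturation I :=
  fun _ hf => ⟨0, fun _ => I.mul_mem_left _ hf⟩

theorem homogeneousComponent_mul_of_isHomogeneous {h : MvPolynomial σ k} {e : ℕ}
    (hh : h.IsHomogeneous e) (f : MvPolynomial σ k) (D : ℕ) :
    homogeneousComponent (D + e) (h * f) = h * homogeneousComponent D f := by
  conv_lhs => rw [← sum_homogeneousComponent f, Finset.mul_sum, map_sum]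
  have hc : ∀ j, homogeneousComponent (D + e) (h * homogeneousComponent j f) =
      if D = j then h * homogeneousComponent D f else 0 := by
    intro j
    have hm : h * homogeneousComponent j f ∈ homogeneousSubmodule σ k (e + j) :=
      hh.mul (homogeneousComponent_isHomogeneous j f)
    rw [homogeneousComponent_of_mem hm]
    by_cases hj : D = j
    · subst hj; rw [if_pos (by omega), if_pos rfl]
    · rw [if_neg (by omega), if_neg hj]
  rw [Finset.sum_congr rfl fun j _ => hc j, Finset.sum_ite_eq]
  split_ifs with hD
  · rfl
  · rw [homogeneousComponent_eq_zero, mul_zero]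
    simpa using hD

theorem isHomogeneousIdeal_saturation {I : Ideal (MvPolynomial σ k)}
    (hI : IsHomogeneousIdeal I) : IsHomogeneousIdeal (saturation I) := by
  rintro f ⟨N, hN⟩ D
  refine ⟨N, fun i => ?_⟩
  have hX : (X i ^ N : MvPolynomial σ k).IsHomogeneous N := isHomogeneous_X_pow i N
  rw [← homogeneousComponent_mul_of_isHomogeneous hX]
  exact hI _ (hN i) _

theorem exists_pow_mul_mem_of_mem_saturation [Finite σ] (I : Ideal (MvPolynomial σ k)) :
    ∃ N : ℕ, ∀ f ∈ saturation I, ∀ i, X i ^ N * f ∈ I := by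
  classical
  obtain ⟨t, ht⟩ := (isNoetherianRing_iff_ideal_fg _).mp
    (inferInstance : IsNoetherianRing (MvPolynomial σ k)) (saturation I)
  have hex : ∀ g : MvPolynomial σ k, ∃ N : ℕ, g ∈ t → ∀ i, X i ^ N * g ∈ I := by
    intro g
    by_cases hg : g ∈ t
    · obtain ⟨N, hN⟩ : g ∈ saturation I := ht ▸ Ideal.subset_span hg
      exact ⟨N, fun _ => hN⟩
    · exact ⟨0, fun h => absurd h hg⟩
  choose N hN using hex
  refine ⟨t.sup N, fun f hf i => ?_⟩
  rw [← ht] at hf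
  induction hf using Submodule.span_induction with
  | mem g hg =>
    obtain ⟨M, hM⟩ := Nat.exists_eq_add_of_le (Finset.le_sup hg : N g ≤ t.sup N)
    rw [hM, add_comm, pow_add, mul_assoc]
    exact I.mul_mem_left _ (hN g hg i)
  | zero => simp
  | add a b _ _ ha hb => rw [mul_add]; exact I.add_mem ha hb
  | smul c a _ ha => rw [smul_eq_mul, mul_left_comm]; exact I.mul_mem_left _ ha

theorem isSaturatedIdeal_saturation [Finite σ] (I : Ideal (MvPolynomial σ k)) :
    IsSaturatedIdeal (saturation I) := by
  rintro f ⟨N, hN⟩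
  obtain ⟨M, hM⟩ := exists_pow_mul_mem_of_mem_saturation I
  refine ⟨M + N, fun i => ?_⟩
  rw [pow_add, mul_assoc]
  exact hM _ (hN i) i

/-- In large degrees an ideal coincides with its saturation. -/
theorem eventually_mem_of_mem_saturation [Finite σ] {I : Ideal (MvPolynomial σ k)}
    (hI : IsHomogeneousIdeal I) :
    ∀ᶠ D in Filter.atTop, ∀ f ∈ saturation I, f.IsHomogeneous D → f ∈ I := by
  classical
  have := Fintype.ofFinite σ
  obtain ⟨N, hN⟩ := exists_pow_mul_mem_of_mem_saturation I
  obtain ⟨t, ht⟩ := (isNoetherianRing_iff_ideal_fg _).mp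
    (inferInstance : IsNoetherianRing (MvPolynomial σ k)) (saturation I)
  have hmon : ∀ (α : σ →₀ ℕ) (c : k) (g : MvPolynomial σ k), g ∈ saturation I →
      Fintype.card σ * N < α.degree → monomial α c * g ∈ I := by
    intro α c g hg hα
    obtain ⟨i, hi⟩ : ∃ i, N ≤ α i := by
      by_contra! hlt
      have h1 : α.degree ≤ Fintype.card σ * N := by
        rw [Finsupp.degree_eq_sum]
        refine (Finset.sum_le_card_nsmul _ _ N fun i _ => (hlt i).le).trans ?_
        simp
      omega
    have h2 : monomial α c = monomial (α - Finsupp.single i N) c * X i ^ N := by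
      rw [X_pow_eq_monomial, monomial_mul, mul_one, tsub_add_cancel_of_le]
      simpa using hi
    rw [h2, mul_assoc]
    exact I.mul_mem_left _ (hN g hg i)
  -- In this range every monomial that multiplies a component of a generator has degree above `card
  -- σ * N`, so some variable occurs in it with exponent at least `N`.
  refine Filter.eventually_atTop.mpr
    ⟨t.sup totalDegree + Fintype.card σ * N + 1, fun D hD f hf hfD => ?_⟩
  suffices h : homogeneousComponent D f ∈ I by rwa [homogeneousComponent_eq_self hfD] at h
  clear hfD
  rw [← ht] at hf
  obtain ⟨a, rfl⟩ := Submodule.mem_span_finset'.mp hf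
  rw [map_sum]
  refine I.sum_mem fun g _ => ?_
  rw [smul_eq_mul]
  have hgs : g.1 ∈ saturation I := ht ▸ Ideal.subset_span g.2
  rw [(a g).as_sum, Finset.sum_mul, map_sum]
  refine I.sum_mem fun α _ => ?_
  rw [← sum_homogeneousComponent g.1, Finset.mul_sum, map_sum]
  refine I.sum_mem fun e he => ?_
  have hm : monomial α ((a g).coeff α) * homogeneousComponent e g.1 ∈
      homogeneousSubmodule σ k (α.degree + e) :=
    (isHomogeneous_monomial _ rfl).mul (homogeneousComponent_isHomogeneous e g.1)
  rw [homogeneousComponent_of_mem hm]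
  split_ifs with h
  · refine hmon _ _ _ (isHomogeneousIdeal_saturation hI _ hgs e) ?_
    have h1 : g.1.totalDegree ≤ t.sup totalDegree := Finset.le_sup g.2
    have h2 := Finset.mem_range.mp he
    omega
  · exact I.zero_mem

end HilbertFunction

/-! ### Intersections and unions of zero-dimensional schemes; uniqueness. -/

section Subscheme

variable {n : ℕ}

theorem ProjSubscheme.isSaturatedIdeal (X : ProjSubscheme n) : IsSaturatedIdeal X.ideal :=
  X.saturated

theorem ProjSubscheme.isHomogeneousIdeal (X : ProjSubscheme n) : IsHomogeneousIdeal X.ideal :=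
  X.homogeneous

theorem ProjSubscheme.hilb_eq {X : ProjSubscheme n} {s : ℕ} (hX : X.IsZeroDimOfDegree s) {D : ℕ}
    (hD : s ≤ D + 1) : hilb X.ideal D = s :=
  hilb_eq_of_eventually_eq X.isSaturatedIdeal hX hD

/-- A homogeneous ideal with constant Hilbert function `s ≤ d + 1` from degree `d` on defines a
subscheme of degree `s` whose ideal has the same forms of degree `d`. -/
theorem exists_projSubscheme_of_hilb_eq {J : Ideal (CoordRing n)} (hJ : IsHomogeneousIdeal J)
    {d s : ℕ} (hs : ∀ D, d ≤ D → hilb J D = s) (hd : s ≤ d + 1) :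
    ∃ X : ProjSubscheme n, X.IsZeroDimOfDegree s ∧
      ∀ f ∈ X.ideal, f.IsHomogeneous d → f ∈ J := by
  let X : ProjSubscheme n := ⟨saturation J, isHomogeneousIdeal_saturation hJ,
    isSaturatedIdeal_saturation J⟩
  have hX : X.IsZeroDimOfDegree s := by
    filter_upwards [eventually_mem_of_mem_saturation hJ, Filter.eventually_ge_atTop d]
      with D hD hdD
    rw [← hs D hdD]
    exact hilb_congr fun f hf => ⟨fun h => hD f h hf, fun h => le_saturation J h⟩
  refine ⟨X, hX, fun f hf hfd => mem_of_hilb_eq (le_saturation J) ?_ hf hfd⟩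
  rw [hs d le_rfl]
  exact (X.hilb_eq hX hd).symm

theorem isSaturatedIdeal_inf {σ k : Type*} [Field k] {I J : Ideal (MvPolynomial σ k)}
    (hI : IsSaturatedIdeal I) (hJ : IsSaturatedIdeal J) : IsSaturatedIdeal (I ⊓ J) :=
  fun f ⟨N, hN⟩ => ⟨hI f ⟨N, fun i => (hN i).1⟩, hJ f ⟨N, fun i => (hN i).2⟩⟩

theorem isHomogeneousIdeal_sup {σ k : Type*} [Field k] {I J : Ideal (MvPolynomial σ k)}
    (hI : IsHomogeneousIdeal I) (hJ : IsHomogeneousIdeal J) : IsHomogeneousIdeal (I ⊔ J) := by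
  intro f hf D
  obtain ⟨a, ha, b, hb, rfl⟩ := Submodule.mem_sup.mp hf
  rw [map_add]
  exact Submodule.add_mem_sup (hI a ha D) (hJ b hb D)

/-- A saturated ideal is determined by its forms of large degree. -/
theorem le_of_eventually_mem {σ k : Type*} [Field k] {I J : Ideal (MvPolynomial σ k)}
    (hI : IsHomogeneousIdeal I) (hJ : IsSaturatedIdeal J)
    (h : ∀ᶠ D in Filter.atTop, ∀ f ∈ I, f.IsHomogeneous D → f ∈ J) : I ≤ J := by
  obtain ⟨N, hN⟩ := Filter.eventually_atTop.mp h
  intro f hf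
  rw [← sum_homogeneousComponent f]
  refine J.sum_mem fun e _ => hJ _ ⟨N, fun i => ?_⟩
  have hX : (MvPolynomial.X i ^ N : MvPolynomial σ k).IsHomogeneous N := isHomogeneous_X_pow i N
  exact hN (N + e) (by omega) _ (I.mul_mem_left _ (hI f hf e))
    (hX.mul (homogeneousComponent_isHomogeneous e f))

theorem pairing_add {d : ℕ} (f g : CoordRing n) (w : SymPow n d) :
    pairing (f + g) w = pairing f w + pairing g w := by
  simp only [pairing, coeff_add, add_mul, Finset.sum_add_distrib]

/-- If a point lies in the spans of two different subschemes of degree `r`, then it lies in the span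
of a subscheme of smaller degree. -/
theorem exists_lt_of_mem_perp_of_ne {r d : ℕ} (hd : 2 * r - 1 ≤ d) {X Y : ProjSubscheme n}
    (hX : X.IsZeroDimOfDegree r) (hY : Y.IsZeroDimOfDegree r) (hXY : X ≠ Y) {w : SymPow n d}
    (hwX : w ∈ X.perp d) (hwY : w ∈ Y.perp d) :
    ∃ s < r, ∃ Z : ProjSubscheme n, Z.IsZeroDimOfDegree s ∧ w ∈ Z.perp d := by
  have hsat := isSaturatedIdeal_inf X.isSaturatedIdeal Y.isSaturatedIdeal
  have hXE : ∀ D, d ≤ D → hilb X.ideal D = r := fun D hD => X.hilb_eq hX (by omega)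
  have hYE : ∀ D, d ≤ D → hilb Y.ideal D = r := fun D hD => Y.hilb_eq hY (by omega)
  have hie := hilb_sup_add_hilb_inf X.isHomogeneousIdeal Y.isHomogeneousIdeal
  -- Here `e` is the degree of the union. The bound `e ≤ 2r ≤ d + 1` makes its Hilbert function
  -- constant already from degree `d`.
  obtain ⟨e, he, hev⟩ := exists_hilb_eq_of_le hsat (r := 2 * r) fun D => by
    refine (hilb_monotone hsat (le_max_left D d)).trans ?_
    have h1 := hie (max D d)
    rw [hXE _ (le_max_right _ _), hYE _ (le_max_right _ _)] at h1
    omega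
  have heE : ∀ D, d ≤ D → hilb (X.ideal ⊓ Y.ideal) D = e := fun D hD =>
    hilb_eq_of_eventually_eq hsat hev (by omega)
  -- If `e ≤ r`, both ideals agree with their intersection in all degrees from `d` on, and
  -- saturation makes them equal.
  have hre : r < e := by
    by_contra! hle
    have hE : ∀ D, d ≤ D → e = r := fun D hD => by
      have := hilb_anti (inf_le_left : X.ideal ⊓ Y.ideal ≤ X.ideal) D
      rw [hXE D hD, heE D hD] at this
      omega
    have hX' : X.ideal ≤ X.ideal ⊓ Y.ideal := le_of_eventually_mem X.isHomogeneousIdeal hsat <| by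
      filter_upwards [Filter.eventually_ge_atTop d] with D hD f hf hfD
      exact mem_of_hilb_eq inf_le_left (by rw [hXE D hD, heE D hD, hE D hD]) hf hfD
    have hY' : Y.ideal ≤ X.ideal ⊓ Y.ideal := le_of_eventually_mem Y.isHomogeneousIdeal hsat <| by
      filter_upwards [Filter.eventually_ge_atTop d] with D hD f hf hfD
      exact mem_of_hilb_eq inf_le_right (by rw [hYE D hD, heE D hD, hE D hD]) hf hfD
    exact hXY (ProjSubscheme.ext (le_antisymm (hX'.trans inf_le_right) (hY'.trans inf_le_left)))
  -- `Z` is the scheme-theoretic intersection. Saturating the sum adds no forms of degree `d`, so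
  -- orthogonality to both ideals suffices.
  obtain ⟨Z, hZ, hZd⟩ := exists_projSubscheme_of_hilb_eq (d := d) (s := 2 * r - e)
    (isHomogeneousIdeal_sup X.isHomogeneousIdeal Y.isHomogeneousIdeal)
    (fun D hD => by
      have h1 := hie D
      rw [hXE D hD, hYE D hD, heE D hD] at h1
      omega) (by omega)
  refine ⟨2 * r - e, by omega, Z, hZ, fun f hf hfd => ?_⟩
  obtain ⟨a, ha, b, hb, hab⟩ := Submodule.mem_sup.mp (hZd f hf hfd)
  rw [← homogeneousComponent_eq_self hfd, ← hab, map_add, pairing_add,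
    hwX _ (X.homogeneous a ha d) (homogeneousComponent_isHomogeneous d a),
    hwY _ (Y.homogeneous b hb d) (homogeneousComponent_isHomogeneous d b), add_zero]

end Subscheme

/-! ### Secant varieties and spans of smoothable schemes. -/

section Secant

variable {n : ℕ}

theorem mem_projectivization_iff_rep_mem {V : Type*} [AddCommGroup V] [Module ℂ V]
    (W : Submodule ℂ V) (p : ℙ ℂ V) : p ∈ W.projectivization ↔ p.rep ∈ W := by
  conv_lhs => rw [← p.mk_rep]
  exact Submodule.mk_mem_projectivization_iff W p.rep_nonzero

theorem mk_mem_span_veronese {q d : ℕ} (x : Fin q → PV n) {z : SymPow n d} (hz : z ≠ 0)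
    (h : z ∈ Submodule.span ℂ (Set.range fun i => veroneseVec d (x i).rep)) :
    Projectivization.mk ℂ z hz ∈
      Projectivization.Subspace.span (Set.range fun i => veronese d (x i)) := by
  rw [← Projectivization.Subspace.mem_submodule_iff]
  refine (Submodule.span_le.mpr ?_) h
  rintro _ ⟨i, rfl⟩
  refine (Projectivization.Subspace.mem_submodule_iff _
    (veroneseVec_ne_zero d (x i).rep_nonzero)).mpr ?_
  exact Projectivization.Subspace.subset_span _ ⟨i, rfl⟩

theorem eval_smul_of_isHomogeneous {ι : Type*} {F : MvPolynomial ι ℂ} {e : ℕ}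
    (hF : F.IsHomogeneous e) (c : ℂ) (w : ι → ℂ) : eval (c • w) F = c ^ e * eval w F := by
  rw [eval_eq, eval_eq, Finset.mul_sum]
  refine Finset.sum_congr rfl fun m hm => ?_
  have hm' : ∑ i ∈ m.support, m i = e := by
    have := hF.degree_eq_sum_deg_support hm
    rw [this]
  simp only [Pi.smul_apply, smul_eq_mul, mul_pow, Finset.prod_mul_distrib,
    Finset.prod_pow_eq_pow_sum, hm']
  ring

theorem eval_mk_rep_eq_zero_iff {ι : Type} {F : MvPolynomial ι ℂ} {e : ℕ}
    (hF : F.IsHomogeneous e) {w : ι → ℂ} (hw : w ≠ 0) :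
    eval (Projectivization.mk ℂ w hw).rep F = 0 ↔ eval w F = 0 := by
  obtain ⟨a, ha⟩ := Projectivization.exists_smul_eq_mk_rep ℂ w hw
  have ha' : (a : ℂ) • w = (Projectivization.mk ℂ w hw).rep := ha
  rw [← ha', eval_smul_of_isHomogeneous hF, mul_eq_zero, or_iff_right (pow_ne_zero _ a.ne_zero)]

/-- The points of the spans of `q` points are linear combinations of their Veronese vectors. -/
theorem exists_rep_eq_sum {q d : ℕ} {a : ℙ ℂ (SymPow n d)} {y : Fin q → ℙ ℂ (SymPow n d)}
    (hy : ∀ i, y i ∈ Set.range (veronese (n := n) d))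
    (ha : a ∈ Projectivization.Subspace.span (Set.range y)) :
    ∃ (x : Fin q → Fin (n + 1) → ℂ) (c : Fin q → ℂ),
      a.rep = ∑ i, c i • veroneseVec d (x i) := by
  choose x hx using hy
  have h : a ∈ (Submodule.span ℂ
      (Set.range fun i => veroneseVec d (x i).rep)).projectivization := by
    refine (Projectivization.Subspace.span_le_subspace_iff.mpr ?_) ha
    rintro _ ⟨i, rfl⟩
    rw [← hx i]
    exact (Submodule.mk_mem_projectivization_iff _ _).mpr (Submodule.subset_span ⟨i, rfl⟩)
  rw [mem_projectivization_iff_rep_mem, Submodule.mem_span_range_iff_exists_fun] at h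
  obtain ⟨c, hc⟩ := h
  exact ⟨fun i => (x i).rep, c, hc.symm⟩

theorem secantVariety_mono {q r : ℕ} (hqr : q ≤ r) (d : ℕ) :
    secantVariety q (Set.range (veronese (n := n) d)) ⊆
      secantVariety r (Set.range (veronese (n := n) d)) := by
  intro p hp e F hF hvan
  refine hp e F hF ?_
  rintro a ⟨y, hy, ha⟩
  refine hvan a ?_
  obtain ⟨x₀⟩ : Nonempty (PV n) := inferInstance
  refine ⟨fun i => if h : i.1 < q then y ⟨i.1, h⟩ else veronese d x₀, fun i => ?_, ?_⟩
  · dsimp only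
    split_ifs
    · exact hy _
    · exact ⟨x₀, rfl⟩
  · refine Projectivization.Subspace.span_le_span ?_ ha
    rintro _ ⟨i, rfl⟩
    exact ⟨Fin.castLE hqr i, by simp⟩

/-- The pairing with a vector, as a linear functional on the coefficients. -/
def coeffPairing {d : ℕ} (w : SymPow n d) : (Mon n d → ℂ) →ₗ[ℂ] ℂ where
  toFun a := ∑ m, a m * w m
  map_add' a b := by simp only [Pi.add_apply, add_mul, Finset.sum_add_distrib]
  map_smul' c a := by
    simp only [Pi.smul_apply, smul_eq_mul, mul_assoc, Finset.mul_sum, RingHom.id_apply]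

/-- The form with given coefficients. -/
def formOfCoeff {d : ℕ} {k : Type*} [CommSemiring k] (a : Mon n d → k) :
    MvPolynomial (Fin (n + 1)) k :=
  ∑ m, monomial m.1 (a m)

theorem degree_of_mem_mon {d : ℕ} (m : Mon n d) : m.1.degree = d := by
  rw [Finsupp.degree_eq_sum]
  exact (Finset.mem_finsuppAntidiag.mp m.2).1

theorem mem_finsuppAntidiag_of_degree {d : ℕ} {m : Fin (n + 1) →₀ ℕ} (h : m.degree = d) :
    m ∈ Finset.finsuppAntidiag (Finset.univ : Finset (Fin (n + 1))) d := by
  rw [Finset.mem_finsuppAntidiag]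
  exact ⟨by rw [← h, Finsupp.degree_eq_sum], Finset.subset_univ _⟩

theorem isHomogeneous_formOfCoeff {d : ℕ} {k : Type*} [CommSemiring k] (a : Mon n d → k) :
    (formOfCoeff a).IsHomogeneous d :=
  IsHomogeneous.sum _ _ _ fun m _ => isHomogeneous_monomial _ (degree_of_mem_mon m)

theorem coeff_formOfCoeff {d : ℕ} {k : Type*} [CommSemiring k] (a : Mon n d → k) (m : Mon n d) :
    (formOfCoeff a).coeff m.1 = a m := by
  classical
  rw [formOfCoeff, coeff_sum, Finset.sum_eq_single m]
  · simp
  · intro m' _ hm'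
    rw [coeff_monomial, if_neg fun h => hm' (Subtype.ext h)]
  · simp

theorem formOfCoeff_coeff {d : ℕ} {k : Type*} [CommSemiring k]
    {f : MvPolynomial (Fin (n + 1)) k} (hf : f.IsHomogeneous d) :
    formOfCoeff (fun m : Mon n d => f.coeff m.1) = f := by
  ext m
  by_cases hm : m.degree = d
  · exact coeff_formOfCoeff _ ⟨m, mem_finsuppAntidiag_of_degree hm⟩
  · rw [hf.coeff_eq_zero hm, (isHomogeneous_formOfCoeff _).coeff_eq_zero hm]

theorem pairing_formOfCoeff {d : ℕ} (a : Mon n d → ℂ) (w : SymPow n d) :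
    pairing (formOfCoeff a) w = coeffPairing w a :=
  Finset.sum_congr rfl fun m _ => by rw [coeff_formOfCoeff]

theorem eval_formOfCoeff {d : ℕ} {k : Type*} [CommSemiring k] (a : Mon n d → k)
    (x : Fin (n + 1) → k) : eval x (formOfCoeff a) = ∑ m : Mon n d, a m * ∏ i, x i ^ m.1 i := by
  rw [formOfCoeff, map_sum]
  refine Finset.sum_congr rfl fun m _ => ?_
  rw [eval_monomial, Finsupp.prod_fintype _ _ fun i => pow_zero _]

/-- The span of distinct points under the Veronese map. -/
theorem perp_le_span_of_isDistinctPoints {q d : ℕ} {Z : Hilb n q} {x : Fin q → PV n}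
    (hx : ∀ (k : ℕ) (f : CoordRing n), f.IsHomogeneous k →
      (f ∈ Z.1.ideal ↔ ∀ i, MvPolynomial.eval (x i).rep f = 0)) :
    Z.1.perp d ≤ Submodule.span ℂ (Set.range fun i => veroneseVec d (x i).rep) := by
  intro w hw
  -- By duality: a form that vanishes at all the points is killed by `w`, so `w` is a combination of
  -- the evaluation functionals.
  have hker : ⨅ i, LinearMap.ker (coeffPairing (veroneseVec d (x i).rep)) ≤
      LinearMap.ker (coeffPairing w) := by
    intro a ha
    rw [LinearMap.mem_ker, ← pairing_formOfCoeff]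
    refine hw _ ((hx d _ (isHomogeneous_formOfCoeff a)).mpr fun i => ?_)
      (isHomogeneous_formOfCoeff a)
    rw [eval_formOfCoeff]
    exact (Submodule.mem_iInf _).mp ha i
  obtain ⟨c, hc⟩ := (Submodule.mem_span_range_iff_exists_fun ℂ).mp
    (mem_span_of_iInf_ker_le_ker hker)
  refine (Submodule.mem_span_range_iff_exists_fun ℂ).mpr ⟨c, ?_⟩
  classical
  ext m
  have := LinearMap.congr_fun hc (Pi.single m 1)
  simpa [coeffPairing, Pi.single_apply] using this

theorem isClosed_affineZariski_eval {κ : Type} (G : MvPolynomial κ ℂ) :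
    IsClosed[affineZariski κ] {x : κ → ℂ | eval x G = 0} := by
  rw [isClosed_induced_iff]
  refine ⟨PrimeSpectrum.zeroLocus {G}, PrimeSpectrum.isClosed_zeroLocus _, ?_⟩
  ext x
  simp only [Set.mem_preimage, PrimeSpectrum.mem_zeroLocus, Set.singleton_subset_iff,
    SetLike.mem_coe, Set.mem_ofPred_eq]
  change G ∈ vanishingIdeal ℂ {x} ↔ _
  rw [mem_vanishingIdeal_iff]
  simp

/-- The subspaces on which a polynomial vanishes form a closed subset of the Grassmannian. -/
theorem isClosed_grassmannianZariski {q : ℕ} {ι : Type} (F : MvPolynomial ι ℂ) :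
    IsClosed[grassmannianZariski q ι]
      {W : Submodule ℂ (ι → ℂ) | ∀ w ∈ W, w ≠ 0 → eval w F = 0} := by
  rw [isClosed_coinduced]
  -- On frames the condition becomes an intersection of zero sets of polynomials in the matrix
  -- entries, one for each coefficient vector `c ≠ 0`. Independence of the frame matches `c ≠ 0`
  -- with nonzero vectors.
  have heq : (fun w : Frame q ι => Submodule.span ℂ (Set.range w.1)) ⁻¹'
      {W : Submodule ℂ (ι → ℂ) | ∀ w ∈ W, w ≠ 0 → eval w F = 0} =
      ⋂ c : {c : Fin q → ℂ // c ≠ 0}, {w : Frame q ι | eval (∑ i, c.1 i • w.1 i) F = 0} := by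
    ext w
    simp only [Set.mem_preimage, Set.mem_ofPred_eq, Set.mem_iInter]
    constructor
    · intro h c
      refine h _ ((Submodule.mem_span_range_iff_exists_fun ℂ).mpr ⟨c.1, rfl⟩) fun h0 => c.2 ?_
      ext i
      exact Fintype.linearIndependent_iff.mp w.2 c.1 h0 i
    · intro h z hz hz0
      obtain ⟨c, rfl⟩ := (Submodule.mem_span_range_iff_exists_fun ℂ).mp hz
      refine h ⟨c, ?_⟩
      rintro rfl
      exact hz0 (by simp)
  rw [heq]
  refine @isClosed_iInter _ _ (frameZariski q ι) _ fun c => ?_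
  refine (@isClosed_induced_iff _ _ (affineZariski (Fin q × ι)) _ _).mpr
    ⟨_, isClosed_affineZariski_eval
    (bind₁ (fun m => ∑ i, C (c.1 i) * X (i, m) : ι → MvPolynomial (Fin q × ι) ℂ) F), ?_⟩
  ext w
  simp only [Set.mem_preimage, Set.mem_ofPred_eq]
  rw [← coe_aeval_eq_eval, RingHom.coe_coe, aeval_bind₁, ← coe_aeval_eq_eval, RingHom.coe_coe]
  have : (fun m => aeval (fun a : Fin q × ι => w.1 a.1 a.2)
      (∑ i, C (c.1 i) * X (i, m) : MvPolynomial (Fin q × ι) ℂ)) = ∑ i, c.1 i • w.1 i := by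
    ext m
    simp
  rw [this]

/-- The span of a smoothable subscheme of degree `q` lies in the `q`-th secant variety. -/
theorem mem_secantVariety_of_isSmoothable {q d : ℕ} (hq : q ≤ d) {Q : Hilb n q}
    (hQ : Q.IsSmoothable) {p : ℙ ℂ (SymPow n d)} (hp : p.rep ∈ Q.1.perp d) :
    p ∈ secantVariety q (Set.range (veronese (n := n) d)) := by
  intro e F hF hvan
  -- The topology of `Hilb n q` is an infimum over all `D ≥ q`, so a set closed for the embedding in
  -- degree `d` is closed.
  have hcl : IsClosed {Z : Hilb n q | ∀ w ∈ Z.1.perp d, w ≠ 0 → eval w F = 0} := by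
    have h1 : IsClosed[TopologicalSpace.induced (fun Z : Hilb n q => Z.1.perp d)
        (grassmannianZariski q (Mon n d))]
        {Z : Hilb n q | ∀ w ∈ Z.1.perp d, w ≠ 0 → eval w F = 0} := by
      exact (@isClosed_induced_iff _ _ (grassmannianZariski q (Mon n d)) _ _).mpr
        ⟨_, isClosed_grassmannianZariski F, rfl⟩
    exact h1.mono (iInf_le (fun D : {D : ℕ // q ≤ D} => TopologicalSpace.induced
      (fun Z : Hilb n q => Z.1.perp D.1) (grassmannianZariski q (Mon n D.1))) ⟨d, hq⟩)
  refine closure_minimal ?_ hcl hQ p.rep hp p.rep_nonzero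
  rintro Z ⟨x, -, hx⟩ w hw hw0
  rw [← eval_mk_rep_eq_zero_iff hF hw0]
  exact hvan _ ⟨fun i => veronese d (x i), fun i => ⟨x i, rfl⟩,
    mk_mem_span_veronese x hw0 (perp_le_span_of_isDistinctPoints hx hw)⟩

end Secant

/-! ### Forms that are socle elements at a point modulo an ideal. -/

section SocleForms

variable {σ k : Type*} [Field k]

/-- Forms `u` of degree `d` that are, modulo `I`, annihilated by the ideal of the point `a` of the
chart `X i = 1`. -/
structure IsSocleForm (I : Ideal (MvPolynomial σ k)) (i : σ) (a : σ → k) (d : ℕ)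
    (u : MvPolynomial σ k) : Prop where
  isHomogeneous : u.IsHomogeneous d
  mul_mem : ∀ j, (X j - C (a j) * X i) * u ∈ I

theorem IsSocleForm.sub_smul {I : Ideal (MvPolynomial σ k)} {i : σ} {a : σ → k} {d : ℕ}
    {u v : MvPolynomial σ k} (hu : IsSocleForm I i a d u) (hv : IsSocleForm I i a d v) (c : k) :
    IsSocleForm I i a d (u - C c * v) where
  isHomogeneous := hu.isHomogeneous.sub (hv.isHomogeneous.C_mul c)
  mul_mem j := by
    rw [mul_sub, mul_left_comm]
    exact I.sub_mem (hu.mul_mem j) (I.mul_mem_left _ (hv.mul_mem j))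

/-- On `u`, modulo `I`, each variable `X j` acts as `a j * X i`; hence a form of degree `e` acts
through its value at `a`, as a multiple of `X i ^ e`. -/
theorem IsSocleForm.mul_sub_mem [Finite σ] {I : Ideal (MvPolynomial σ k)} {i : σ} {a : σ → k}
    {d : ℕ} {u : MvPolynomial σ k} (hu : IsSocleForm I i a d u) {e : ℕ} {f : MvPolynomial σ k}
    (hf : f.IsHomogeneous e) : f * u - C (eval a f) * X i ^ e * u ∈ I := by
  have := Fintype.ofFinite σ
  induction e generalizing f with
  | zero =>
    have h0 : f = C (coeff 0 f) := by
      rw [← homogeneousComponent_zero, homogeneousComponent_eq_self hf]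
    rw [h0]
    simp
  | succ e ih =>
    obtain ⟨g, hg, rfl⟩ := exists_eq_sum_X_mul hf
    simp only [map_sum, map_mul, eval_X, Finset.sum_mul]
    rw [← Finset.sum_sub_distrib]
    refine I.sum_mem fun j _ => ?_
    have h1 : X j * g j * u - C (a j) * C (eval a (g j)) * X i ^ (e + 1) * u =
        X j * (g j * u - C (eval a (g j)) * X i ^ e * u) +
        C (eval a (g j)) * X i ^ e * ((X j - C (a j) * X i) * u) := by ring
    rw [h1]
    exact I.add_mem (I.mul_mem_left _ (ih (hg j))) (I.mul_mem_left _ (hu.mul_mem j))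

/-- Modulo `I`, `X j ^ e * u` is a scalar multiple of `X i ^ e * u` for every `j`. If the latter
vanished, saturation would give `u ∈ I`. -/
theorem IsSocleForm.X_pow_mul_notMem [Finite σ] {I : Ideal (MvPolynomial σ k)}
    (hI : IsSaturatedIdeal I) {i : σ} {a : σ → k} {d : ℕ} {u : MvPolynomial σ k}
    (hu : IsSocleForm I i a d u) (huI : u ∉ I) (e : ℕ) : X i ^ e * u ∉ I := by
  intro h
  refine huI (hI u ⟨e, fun j => ?_⟩)
  have h1 := hu.mul_sub_mem (isHomogeneous_X_pow (R := k) j e)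
  have h2 := I.mul_mem_left (C (eval a (X j ^ e))) h
  rw [← mul_assoc] at h2
  simpa using I.add_mem h1 h2

theorem isHomogeneousIdeal_span_singleton {d : ℕ} {u : MvPolynomial σ k}
    (hu : u.IsHomogeneous d) : IsHomogeneousIdeal (Ideal.span {u}) := by
  intro f hf D
  obtain ⟨b, rfl⟩ := Ideal.mem_span_singleton'.mp hf
  rw [mul_comm]
  by_cases hD : d ≤ D
  · obtain ⟨e, rfl⟩ := Nat.exists_eq_add_of_le' hD
    rw [homogeneousComponent_mul_of_isHomogeneous hu]
    exact Ideal.mul_mem_right _ _ (Ideal.mem_span_singleton_self u)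
  · have h0 : homogeneousComponent D (u * b) = 0 := by
      rw [← sum_homogeneousComponent b, Finset.mul_sum, map_sum]
      refine Finset.sum_eq_zero fun e _ => ?_
      have hm : u * homogeneousComponent e b ∈ homogeneousSubmodule σ k (d + e) :=
        hu.mul (homogeneousComponent_isHomogeneous e b)
      rw [homogeneousComponent_of_mem hm, if_neg (by omega)]
    rw [h0]
    exact Ideal.zero_mem _

/-- Adding a socle form to a saturated ideal lowers the Hilbert function by one. -/
theorem IsSocleForm.hilb_sup_add_one [Finite σ] {I : Ideal (MvPolynomial σ k)}
    (hI : IsSaturatedIdeal I) (hIh : IsHomogeneousIdeal I) {i : σ} {a : σ → k} {d : ℕ}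
    {u : MvPolynomial σ k} (hu : IsSocleForm I i a d u) (huI : u ∉ I) {D : ℕ} (hD : d ≤ D) :
    hilb (I ⊔ Ideal.span {u}) D + 1 = hilb I D := by
  obtain ⟨e, rfl⟩ := Nat.exists_eq_add_of_le' hD
  have hv : (X i ^ e * u).IsHomogeneous (e + d) := (isHomogeneous_X_pow i e).mul hu.isHomogeneous
  let v : homogeneousSubmodule σ k (e + d) := ⟨X i ^ e * u, hv⟩
  have hvI : v ∉ gradedPart I (e + d) := hu.X_pow_mul_notMem hI huI e
  -- Multiples of `u` contribute in each degree just one line modulo `I`, spanned by `X i ^ e * u`.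
  have heq : gradedPart (I ⊔ Ideal.span {u}) (e + d) = gradedPart I (e + d) ⊔ k ∙ v := by
    apply le_antisymm
    · rintro ⟨f, hf⟩ hfJ
      obtain ⟨b, hb, c, hc, hbc⟩ := Submodule.mem_sup.mp (mem_gradedPart.mp hfJ)
      obtain ⟨c, rfl⟩ := Ideal.mem_span_singleton'.mp hc
      have hfe : f = homogeneousComponent (e + d) b + u * homogeneousComponent e c := by
        rw [← homogeneousComponent_mul_of_isHomogeneous hu.isHomogeneous, mul_comm u, ← map_add,
          hbc]
        exact (homogeneousComponent_eq_self hf).symm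
      have hsub := hu.mul_sub_mem (homogeneousComponent_isHomogeneous e c)
      refine Submodule.mem_sup.mpr ⟨⟨f, hf⟩ - eval a (homogeneousComponent e c) • v, ?_,
        eval a (homogeneousComponent e c) • v, Submodule.smul_mem _ _
          (Submodule.mem_span_singleton_self v), by simp⟩
      change f - eval a (homogeneousComponent e c) • (X i ^ e * u) ∈ I
      rw [hfe, smul_eq_C_mul, ← mul_assoc, mul_comm u, add_sub_assoc]
      exact I.add_mem (hIh b hb _) hsub
    · refine sup_le (gradedPart_mono le_sup_left _) ?_
      rw [Submodule.span_singleton_le_iff_mem]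
      exact (I ⊔ Ideal.span {u}).mul_mem_left _
        (Ideal.mem_sup_right (Ideal.mem_span_singleton_self u))
  have h1 := hilb_add_finrank I (e + d)
  have h2 := hilb_add_finrank (I ⊔ Ideal.span {u}) (e + d)
  rw [heq, Submodule.finrank_sup_span_singleton hvI] at h2
  omega

/-- Where the Hilbert function is constant, `u` is divisible by `l` modulo `I`. Regularity of `l`
makes the quotient a socle form again, on which `l` acts as `eval a l` times `X i`. -/
theorem IsSocleForm.exists_of_succ [Finite σ] {I : Ideal (MvPolynomial σ k)}
    {l : MvPolynomial σ k} (hl : l.IsHomogeneous 1) (h : ∀ f, l * f ∈ I → f ∈ I) {D : ℕ}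
    (hD : hilb I D = hilb I (D + 1)) {i : σ} {a : σ → k} {u : MvPolynomial σ k}
    (hu : IsSocleForm I i a (D + 1) u) :
    ∃ v, IsSocleForm I i a D v ∧ u - C (eval a l) * (X i * v) ∈ I := by
  obtain ⟨v, hv, huv⟩ := exists_mul_sub_mem_of_hilb_eq hl h hD hu.isHomogeneous
  have hvs : IsSocleForm I i a D v := by
    refine ⟨hv, fun j => h _ ?_⟩
    have h1 : l * ((X j - C (a j) * X i) * v) =
        (X j - C (a j) * X i) * u - (X j - C (a j) * X i) * (u - l * v) := by ring
    rw [h1]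
    exact I.sub_mem (hu.mul_mem j) (I.mul_mem_left _ huv)
  refine ⟨v, hvs, ?_⟩
  have h2 := I.add_mem huv (hvs.mul_sub_mem hl)
  rw [pow_one] at h2
  convert h2 using 1
  ring

end SocleForms

/-! ### Homogenization with respect to one variable. -/

section Homogenize

variable {σ k : Type*} [Field k]

/-- Homogenization in degree `N` with respect to the variable `X i`. -/
def homogenizeAt (i : σ) (N : ℕ) (f : MvPolynomial σ k) : MvPolynomial σ k :=
  ∑ e ∈ Finset.range (N + 1), X i ^ (N - e) * homogeneousComponent e f

theorem homogenizeAt_add (i : σ) (N : ℕ) (f g : MvPolynomial σ k) :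
    homogenizeAt i N (f + g) = homogenizeAt i N f + homogenizeAt i N g := by
  simp only [homogenizeAt, map_add, mul_add, Finset.sum_add_distrib]

theorem homogenizeAt_sub (i : σ) (N : ℕ) (f g : MvPolynomial σ k) :
    homogenizeAt i N (f - g) = homogenizeAt i N f - homogenizeAt i N g := by
  simp only [homogenizeAt, map_sub, mul_sub, Finset.sum_sub_distrib]

theorem isHomogeneous_homogenizeAt (i : σ) (N : ℕ) (f : MvPolynomial σ k) :
    (homogenizeAt i N f).IsHomogeneous N := by
  refine IsHomogeneous.sum _ _ _ fun e he => ?_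
  have h := (isHomogeneous_X_pow (R := k) i (N - e)).mul (homogeneousComponent_isHomogeneous e f)
  rwa [Nat.sub_add_cancel (Nat.lt_succ_iff.mp (Finset.mem_range.mp he))] at h

theorem homogenizeAt_mem {I : Ideal (MvPolynomial σ k)} (hI : IsHomogeneousIdeal I) (i : σ)
    (N : ℕ) {f : MvPolynomial σ k} (hf : f ∈ I) : homogenizeAt i N f ∈ I :=
  I.sum_mem fun e _ => I.mul_mem_left _ (hI f hf e)

theorem homogenizeAt_of_isHomogeneous (i : σ) {N e : ℕ} (he : e ≤ N) {f : MvPolynomial σ k}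
    (hf : f.IsHomogeneous e) : homogenizeAt i N f = X i ^ (N - e) * f := by
  rw [homogenizeAt, Finset.sum_eq_single e]
  · rw [homogeneousComponent_eq_self hf]
  · intro b _ hb
    rw [homogeneousComponent_of_mem hf, if_neg hb, mul_zero]
  · intro h
    exact absurd (Finset.mem_range.mpr (Nat.lt_succ_of_le he)) h

/-- Consequently multiples of `X i - 1` homogenize to zero in large degree, which removes the chart
equation. -/
theorem homogenizeAt_X_mul (i : σ) {N : ℕ} {f : MvPolynomial σ k} (hf : f.totalDegree < N) :
    homogenizeAt i N (X i * f) = homogenizeAt i N f := by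
  rw [homogenizeAt, homogenizeAt, Finset.sum_range_succ', Finset.sum_range_succ,
    homogeneousComponent_eq_zero _ _ hf, mul_zero, add_zero, homogeneousComponent_zero]
  have h0 : coeff 0 (X i * f) = 0 := by
    classical simp [coeff_X_mul']
  rw [h0, map_zero, mul_zero, add_zero]
  refine Finset.sum_congr rfl fun e he => ?_
  rw [homogeneousComponent_mul_of_isHomogeneous (isHomogeneous_X k i), ← mul_assoc, ← pow_succ]
  congr 2
  have := Finset.mem_range.mp he
  omega

/-- A form that vanishes on the part of the scheme in the chart `X i = 1` lies in the ideal after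
multiplication by a power of `X i`. -/
theorem exists_X_pow_mul_mem {I : Ideal (MvPolynomial σ k)} (hI : IsHomogeneousIdeal I) {i : σ}
    {e : ℕ} {f : MvPolynomial σ k} (hf : f.IsHomogeneous e)
    (h : f ∈ I ⊔ Ideal.span {(X i : MvPolynomial σ k) - 1}) : ∃ N : ℕ, X i ^ N * f ∈ I := by
  obtain ⟨b, hb, c, hc, hbc⟩ := Submodule.mem_sup.mp h
  obtain ⟨c, rfl⟩ := Ideal.mem_span_singleton'.mp hc
  let N := e + c.totalDegree + 1
  refine ⟨N - e, ?_⟩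
  rw [← homogenizeAt_of_isHomogeneous i (by omega) hf, ← hbc, homogenizeAt_add, mul_sub, mul_one,
    mul_comm c, homogenizeAt_sub, homogenizeAt_X_mul i (by omega), sub_self, add_zero]
  exact homogenizeAt_mem hI i N hb

end Homogenize

/-! ### Schemes of minimal degree are Gorenstein. -/

section Gorenstein

variable {n : ℕ}

theorem pairing_sub {d : ℕ} (f g : CoordRing n) (w : SymPow n d) :
    pairing (f - g) w = pairing f w - pairing g w := by
  simp only [pairing, coeff_sub, sub_mul, Finset.sum_sub_distrib]

theorem pairing_C_mul {d : ℕ} (c : ℂ) (f : CoordRing n) (w : SymPow n d) :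
    pairing (C c * f) w = c * pairing f w := by
  simp only [pairing, coeff_C_mul, mul_assoc, Finset.mul_sum]

/-- A socle form that is orthogonal to `w` yields a smaller subscheme whose span contains `w`. -/
theorem IsSocleForm.mem_of_minimal {q d : ℕ} (hd : q ≤ d + 1) {X : ProjSubscheme n}
    (hX : X.IsZeroDimOfDegree q) {w : SymPow n d} (hw : w ∈ X.perp d)
    (hmin : ∀ s < q, ∀ Z : ProjSubscheme n, Z.IsZeroDimOfDegree s → w ∉ Z.perp d)
    {i : Fin (n + 1)} {a : Fin (n + 1) → ℂ} {u : CoordRing n}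
    (hu : IsSocleForm X.ideal i a d u) (huw : pairing u w = 0) : u ∈ X.ideal := by
  by_contra huI
  -- Adding `u` lowers the degree to `q - 1`. In degree `d` the ideal gains only the line through
  -- `u`, which is orthogonal to `w`, so minimality is contradicted.
  have hh : ∀ D, d ≤ D → hilb (X.ideal ⊔ Ideal.span {u}) D + 1 = q := fun D hD => by
    rw [hu.hilb_sup_add_one X.isSaturatedIdeal X.isHomogeneousIdeal huI hD]
    exact X.hilb_eq hX (by omega)
  have hq := hh d le_rfl
  obtain ⟨Z, hZ, hZd⟩ := exists_projSubscheme_of_hilb_eq (d := d) (s := q - 1)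
    (isHomogeneousIdeal_sup X.isHomogeneousIdeal
      (isHomogeneousIdeal_span_singleton hu.isHomogeneous))
    (fun D hD => by have := hh D hD; omega) (by omega)
  refine hmin (q - 1) (by omega) Z hZ fun f hf hfd => ?_
  obtain ⟨b, hb, c, hc, hbc⟩ := Submodule.mem_sup.mp (hZd f hf hfd)
  obtain ⟨c, rfl⟩ := Ideal.mem_span_singleton'.mp hc
  have h1 := homogeneousComponent_mul_of_isHomogeneous hu.isHomogeneous c 0
  rw [zero_add, homogeneousComponent_zero, mul_comm, mul_comm u] at h1
  rw [← homogeneousComponent_eq_self hfd, ← hbc, map_add, pairing_add, h1, pairing_C_mul, huw,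
    hw _ (X.homogeneous b hb d) (homogeneousComponent_isHomogeneous d b), mul_zero, add_zero]

variable (X : ProjSubscheme n) (i : Fin (n + 1))

/-- The restriction of forms to a chart. -/
def chartMap : CoordRing n →ₐ[ℂ] X.ChartRing i :=
  Ideal.Quotient.mkₐ ℂ _

theorem chartMap_surjective : Function.Surjective (chartMap X i) :=
  Ideal.Quotient.mkₐ_surjective ℂ _

theorem chartMap_eq_zero_iff {f : CoordRing n} : chartMap X i f = 0 ↔
    f ∈ X.ideal ⊔ Ideal.span {(MvPolynomial.X i : CoordRing n) - 1} :=
  Ideal.Quotient.eq_zero_iff_mem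

theorem chartMap_eq_zero_of_mem {f : CoordRing n} (hf : f ∈ X.ideal) : chartMap X i f = 0 :=
  (chartMap_eq_zero_iff X i).mpr (Ideal.mem_sup_left hf)

theorem chartMap_X : chartMap X i (MvPolynomial.X i) = 1 := by
  rw [← sub_eq_zero, ← map_one (chartMap X i), ← map_sub, chartMap_eq_zero_iff]
  exact Ideal.mem_sup_right (Ideal.mem_span_singleton_self _)

theorem chartMap_homogenizeAt {N : ℕ} {f : CoordRing n} (hN : f.totalDegree ≤ N) :
    chartMap X i (homogenizeAt i N f) = chartMap X i f := by
  conv_rhs => rw [← sum_homogeneousComponent f, map_sum]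
  rw [homogenizeAt, map_sum]
  simp only [map_mul, map_pow, chartMap_X, one_pow, one_mul]
  refine (Finset.sum_subset (Finset.range_subset_range.mpr (by omega)) fun e _ he => ?_).symm
  rw [homogeneousComponent_eq_zero, map_zero]
  simpa using he

/-- The image of the forms of degree `D` in the chart. -/
def chartImage (D : ℕ) : Submodule ℂ (X.ChartRing i) :=
  (homogeneousSubmodule (Fin (n + 1)) ℂ D).map (chartMap X i).toLinearMap

theorem chartImage_mono : Monotone (chartImage X i) := by
  refine monotone_nat_of_le_succ fun D => ?_
  rintro _ ⟨f, hf, rfl⟩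
  refine ⟨MvPolynomial.X i * f, mul_mem_homogeneousSubmodule_succ (isHomogeneous_X ℂ i) hf, ?_⟩
  simp [chartMap_X]

instance finiteDimensional_chartImage (D : ℕ) : FiniteDimensional ℂ (chartImage X i D) := by
  unfold chartImage
  infer_instance

theorem finrank_chartImage_le (D : ℕ) : Module.finrank ℂ (chartImage X i D) ≤ hilb X.ideal D := by
  let φ : homogeneousSubmodule (Fin (n + 1)) ℂ D →ₗ[ℂ] X.ChartRing i :=
    (chartMap X i).toLinearMap ∘ₗ (homogeneousSubmodule (Fin (n + 1)) ℂ D).subtype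
  have hφ : gradedPart X.ideal D ≤ LinearMap.ker φ := fun f hf =>
    chartMap_eq_zero_of_mem X i hf
  have hr : chartImage X i D = LinearMap.range ((gradedPart X.ideal D).liftQ φ hφ) := by
    rw [Submodule.range_liftQ, LinearMap.range_comp, Submodule.range_subtype]
    rfl
  rw [hr]
  exact LinearMap.finrank_range_le _

variable {X i}

/-- Since `X i` becomes 1, the images of the forms of degree `D` grow with `D`. Their dimensions are
at most `q`, so they stabilize, and together they span the chart ring. -/
theorem finite_chartRing {q : ℕ} (hX : X.IsZeroDimOfDegree q) :
    Module.Finite ℂ (X.ChartRing i) := by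
  have hle : ∀ D, Module.finrank ℂ (chartImage X i D) ≤ q := fun D => by
    refine (Submodule.finrank_mono (chartImage_mono X i (le_max_left D q))).trans ?_
    refine (finrank_chartImage_le X i _).trans (X.hilb_eq hX ?_).le
    have := le_max_right D q
    omega
  have hbdd : BddAbove (Set.range fun D => Module.finrank ℂ (chartImage X i D)) :=
    ⟨q, by rintro _ ⟨D, rfl⟩; exact hle D⟩
  obtain ⟨N, hN⟩ := Nat.sSup_mem (Set.range_nonempty _) hbdd
  have hstab : ∀ D, chartImage X i D ≤ chartImage X i N := fun D => by
    have h1 : chartImage X i N = chartImage X i (max D N) :=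
      Submodule.eq_of_le_of_finrank_le (chartImage_mono X i (le_max_right D N)) <| by
        change _ ≤ (fun D => Module.finrank ℂ (chartImage X i D)) N
        rw [hN]
        exact le_csSup hbdd ⟨_, rfl⟩
    rw [h1]
    exact chartImage_mono X i (le_max_left D N)
  have htop : chartImage X i N = ⊤ := by
    refine eq_top_iff.mpr fun c _ => ?_
    obtain ⟨f, rfl⟩ := chartMap_surjective X i c
    rw [← sum_homogeneousComponent f, map_sum]
    exact Submodule.sum_mem _ fun e _ =>
      hstab e ⟨_, homogeneousComponent_isHomogeneous e f, rfl⟩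
  have := Module.Finite.equiv (LinearEquiv.ofTop _ htop)
  exact this

/-- A point of a chart has coordinates in `ℂ`. -/
theorem exists_sub_algebraMap_mem {A : Type*} [CommRing A] [Algebra ℂ A] [Module.Finite ℂ A]
    (m : Ideal A) [m.IsMaximal] (c : A) : ∃ z : ℂ, c - algebraMap ℂ A z ∈ m := by
  obtain ⟨z, hz⟩ := (IsAlgClosed.algebraMap_bijective_of_isIntegral (k := ℂ) (K := A ⧸ m)).2
    (Ideal.Quotient.mk m c)
  refine ⟨z, ?_⟩
  rw [← Ideal.Quotient.eq_zero_iff_mem, map_sub, ← hz, sub_eq_zero]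
  rfl

/-- The socle of an Artinian local ring is not zero. -/
theorem annihilator_maximalIdeal_ne_bot (A : Type*) [CommRing A] [IsLocalRing A]
    [IsArtinianRing A] : Submodule.annihilator (IsLocalRing.maximalIdeal A) ≠ ⊥ := by
  have hnil : IsNilpotent (IsLocalRing.maximalIdeal A) := by
    rw [← IsLocalRing.jacobson_eq_maximalIdeal ⊥ bot_ne_top]
    exact IsArtinianRing.isNilpotent_jacobson_bot
  classical
  -- The last nonzero power of the maximal ideal annihilates the maximal ideal.
  have hN := Nat.find_spec hnil
  have hpos : Nat.find hnil ≠ 0 := by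
    intro h0
    rw [h0, pow_zero] at hN
    exact one_ne_zero hN
  obtain ⟨N, hN'⟩ := Nat.exists_eq_succ_of_ne_zero hpos
  have hlt := Nat.find_min hnil (m := N) (by omega)
  rw [hN', Nat.succ_eq_add_one, pow_succ] at hN
  intro hbot
  refine hlt (le_bot_iff.mp ?_)
  rw [← hbot]
  intro x hx
  rw [Submodule.mem_annihilator]
  intro y hy
  have : x * y ∈ IsLocalRing.maximalIdeal A ^ N * IsLocalRing.maximalIdeal A :=
    Ideal.mul_mem_mul hx hy
  rw [hN] at this
  exact this

/-- Socle elements of the local rings come from socle forms of large degree. -/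
theorem exists_isSocleForm_of_mem_annihilator {m : Ideal (X.ChartRing i)} [m.IsMaximal]
    [Module.Finite ℂ (X.ChartRing i)] {a : Fin (n + 1) → ℂ}
    (ha : ∀ j, chartMap X i (MvPolynomial.X j - C (a j)) ∈ m) (d : ℕ)
    {b : Localization.AtPrime m}
    (hb : b ∈ Submodule.annihilator (IsLocalRing.maximalIdeal (Localization.AtPrime m))) :
    ∃ e u, IsSocleForm X.ideal i a (d + e) u ∧
      algebraMap (X.ChartRing i) (Localization.AtPrime m) (chartMap X i u) = b := by
  have hart : IsArtinianRing (X.ChartRing i) := IsArtinianRing.of_finite ℂ _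
  let L := Localization.AtPrime m
  have hbm : ∀ c ∈ m, algebraMap (X.ChartRing i) L c * b = 0 := fun c hc => by
    rw [mul_comm]
    refine Submodule.mem_annihilator.mp hb _ ?_
    rw [← IsLocalization.AtPrime.map_eq_maximalIdeal m]
    exact Ideal.mem_map_of_mem _ hc
  obtain ⟨c, rfl⟩ := IsArtinianRing.localization_surjective m.primeCompl L b
  have hs : ∀ j, ∃ s : m.primeCompl, s * (chartMap X i (MvPolynomial.X j - C (a j)) * c) = 0 := by
    intro j
    have h1 := hbm _ (ha j)
    rw [← map_mul, IsLocalization.map_eq_zero_iff m.primeCompl] at h1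
    exact h1
  choose s hs using hs
  -- `t` kills all obstructions to the relations `(X j - a j) * c = 0` at once. It is congruent to a
  -- nonzero scalar `z` modulo `m`, and `m` kills the socle element, so `z⁻¹ * t * c` still
  -- represents it.
  let t : m.primeCompl := ∏ j, s j
  obtain ⟨z, hz⟩ := exists_sub_algebraMap_mem m (t : X.ChartRing i)
  have hz0 : z ≠ 0 := by
    rintro rfl
    rw [map_zero, sub_zero] at hz
    exact t.2 hz
  obtain ⟨f, hf⟩ := chartMap_surjective X i (algebraMap ℂ _ z⁻¹ * (t * c))
  have hfb : algebraMap (X.ChartRing i) L (chartMap X i f) = algebraMap _ L c := by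
    have h1 := hbm _ hz
    rw [map_sub, sub_mul, sub_eq_zero] at h1
    rw [hf, map_mul, map_mul, h1, ← map_mul, ← map_mul, ← mul_assoc, ← map_mul,
      inv_mul_cancel₀ hz0, map_one, one_mul]
  have hfm : ∀ j, chartMap X i ((MvPolynomial.X j - C (a j)) * f) = 0 := fun j => by
    obtain ⟨t', ht'⟩ := Finset.dvd_prod_of_mem s (Finset.mem_univ j)
    have ht : (t : X.ChartRing i) = s j * t' := congrArg Subtype.val ht'
    rw [map_mul, hf, ht]
    have := hs j
    linear_combination (algebraMap ℂ (X.ChartRing i) z⁻¹ * (t' : X.ChartRing i)) * this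
  let N := f.totalDegree
  let g := homogenizeAt i N f
  have hg : g.IsHomogeneous N := isHomogeneous_homogenizeAt i N f
  have hgf : chartMap X i g = chartMap X i f := chartMap_homogenizeAt X i le_rfl
  have hex : ∀ j, ∃ M : ℕ, MvPolynomial.X i ^ M *
      ((MvPolynomial.X j - C (a j) * MvPolynomial.X i) * g) ∈ X.ideal := fun j => by
    refine exists_X_pow_mul_mem X.isHomogeneousIdeal (e := 1 + N)
      (((isHomogeneous_X ℂ j).sub (isHomogeneous_C_mul_X (a j) i)).mul hg) ?_
    rw [← chartMap_eq_zero_iff, ← hfm j]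
    simp only [map_mul, map_sub, chartMap_X, mul_one, hgf]
  choose M hM using hex
  -- The sum makes all the homogeneous relations hold in the ideal itself; the summand `d` raises
  -- the degree to at least `d`.
  let K := d + ∑ j, M j
  refine ⟨∑ j, M j + N, MvPolynomial.X i ^ K * g, ⟨?_, fun j => ?_⟩, ?_⟩
  · rw [← add_assoc]
    exact (isHomogeneous_X_pow i K).mul hg
  · obtain ⟨K', hK'⟩ : ∃ K', K = K' + M j := Nat.exists_eq_add_of_le'
      ((Finset.single_le_sum (fun _ _ => Nat.zero_le _) (Finset.mem_univ j)).trans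
        (Nat.le_add_left _ _))
    have h1 : (MvPolynomial.X j - C (a j) * MvPolynomial.X i) * (MvPolynomial.X i ^ K * g) =
        MvPolynomial.X i ^ K' * (MvPolynomial.X i ^ M j *
          ((MvPolynomial.X j - C (a j) * MvPolynomial.X i) * g)) := by
      rw [hK']; ring
    rw [h1]
    exact X.ideal.mul_mem_left _ (hM j)
  · rw [map_mul, map_pow, chartMap_X, one_pow, one_mul, hgf, hfb]

/-- A scheme of minimal degree whose span contains a given point is Gorenstein. -/
theorem isGorenstein_of_minimal {q d : ℕ} (hd : q ≤ d + 1)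
    (hX : X.IsZeroDimOfDegree q) {w : SymPow n d} (hw : w ∈ X.perp d)
    (hmin : ∀ s < q, ∀ Z : ProjSubscheme n, Z.IsZeroDimOfDegree s → w ∉ Z.perp d) :
    X.IsGorenstein := by
  intro i m hm
  have hfin : Module.Finite ℂ (X.ChartRing i) := finite_chartRing hX
  have hart : IsArtinianRing (X.ChartRing i) := IsArtinianRing.of_finite ℂ _
  let L := Localization.AtPrime m
  let φ : CoordRing n →+* L := (algebraMap (X.ChartRing i) L).comp (chartMap X i).toRingHom
  have hφI : ∀ f ∈ X.ideal, φ f = 0 := fun f hf => by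
    change algebraMap (X.ChartRing i) L (chartMap X i f) = 0
    rw [chartMap_eq_zero_of_mem X i hf, map_zero]
  have hφX : φ (MvPolynomial.X i) = 1 := by
    change algebraMap (X.ChartRing i) L (chartMap X i _) = 1
    rw [chartMap_X, map_one]
  have hφC : ∀ z, φ (C z) = algebraMap ℂ L z := fun z => by
    change algebraMap (X.ChartRing i) L (chartMap X i (algebraMap ℂ _ z)) = _
    rw [AlgHom.commutes, ← IsScalarTower.algebraMap_apply]
  choose a ha using fun j => exists_sub_algebraMap_mem m (chartMap X i (MvPolynomial.X j))
  have ha' : ∀ j, chartMap X i (MvPolynomial.X j - C (a j)) ∈ m := fun j => by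
    have h := ha j
    rwa [← AlgHom.commutes (chartMap X i), ← map_sub] at h
  obtain ⟨l, hl, hreg⟩ := exists_linearForm_regular X.isSaturatedIdeal
  -- Socle forms exist in some degree `d + e`. The Hilbert function is constant from `d` on, so they
  -- descend one degree at a time without changing their image.
  have hlift : ∀ b ∈ Submodule.annihilator (IsLocalRing.maximalIdeal L), b ≠ 0 →
      ∃ u, IsSocleForm X.ideal i a d u ∧ φ u = b := by
    intro b hb hb0
    obtain ⟨e, he⟩ := exists_isSocleForm_of_mem_annihilator ha' d hb
    induction e with
    | zero => exact he
    | succ e ih =>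
      obtain ⟨u, hu, hub⟩ := he
      obtain ⟨v, hv, huv⟩ := hu.exists_of_succ (D := d + e) hl hreg
        ((X.hilb_eq hX (by omega)).trans (X.hilb_eq hX (by omega)).symm)
      have h1 := hφI _ huv
      rw [map_sub, map_mul, map_mul, hφX, one_mul, sub_eq_zero] at h1
      refine ih ⟨C (eval a l) * v, ⟨hv.isHomogeneous.C_mul _, fun j => ?_⟩, ?_⟩
      · rw [mul_left_comm]
        exact X.ideal.mul_mem_left _ (hv.mul_mem j)
      · change φ _ = b
        rw [map_mul, ← h1]
        exact hub
  obtain ⟨b, hb, hb0⟩ := Submodule.exists_mem_ne_zero_of_ne_bot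
    (annihilator_maximalIdeal_ne_bot L)
  obtain ⟨u, hu, hub⟩ := hlift b hb hb0
  have huw : pairing u w ≠ 0 := fun h => hb0 <| by
    rw [← hub]
    exact hφI u (hu.mem_of_minimal hd hX hw hmin h)
  refine (finrank_eq_one_iff' (K := ℂ)).mpr ⟨⟨b, hb⟩, fun h => hb0 (congrArg Subtype.val h), ?_⟩
  rintro ⟨c, hc⟩
  by_cases hc0 : c = 0
  · exact ⟨0, by rw [zero_smul]; exact Subtype.ext hc0.symm⟩
  obtain ⟨v, hv, hvc⟩ := hlift c hc hc0
  -- The scalar makes the difference orthogonal to `w`, hence zero modulo the ideal by minimality: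
  -- every socle element is a multiple of `b`.
  have hmem := (hv.sub_smul hu (pairing v w / pairing u w)).mem_of_minimal hd hX hw hmin (by
    rw [pairing_sub, pairing_C_mul, div_mul_cancel₀ _ huw, sub_self])
  have h1 := hφI _ hmem
  rw [map_sub, map_mul, hφC, hub, hvc, sub_eq_zero, ← Algebra.smul_def] at h1
  exact ⟨_, Subtype.ext h1.symm⟩

end Gorenstein

/-! ### Extension of specializations to valuation rings. -/

section Place

variable {k K : Type*} [Field k] [Field K] [Algebra k K]

/-- The first projection of a subalgebra of `K × k`. -/
def graphFst (G : Subalgebra k (K × k)) : G →+* K := (RingHom.fst K k).comp G.val.toRingHom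

/-- The second projection of a subalgebra of `K × k`. -/
def graphSnd (G : Subalgebra k (K × k)) : G →+* k := (RingHom.snd K k).comp G.val.toRingHom

/-- A subalgebra of `K × k` that is the graph of a homomorphism from a subalgebra of `K`. -/
def IsGraph (G : Subalgebra k (K × k)) : Prop := ∀ c : k, ((0 : K), c) ∈ G → c = 0

theorem IsGraph.snd_eq_zero {G : Subalgebra k (K × k)} (hG : IsGraph G) {g : G}
    (hg : graphFst G g = 0) : graphSnd G g = 0 :=
  hG _ (by
    have : ((0 : K), graphSnd G g) = g.1 := Prod.ext hg.symm rfl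
    rw [this]
    exact g.2)

theorem IsGraph.fst_injective {G : Subalgebra k (K × k)} (hG : IsGraph G) :
    Function.Injective (graphFst G) := by
  rw [injective_iff_map_eq_zero]
  intro g hg
  exact Subtype.ext (Prod.ext hg (hG.snd_eq_zero hg))

theorem graphSnd_surjective (G : Subalgebra k (K × k)) : Function.Surjective (graphSnd G) :=
  fun z => ⟨algebraMap k G z, rfl⟩

theorem exists_maximal_isGraph {G₀ : Subalgebra k (K × k)} (h₀ : IsGraph G₀) :
    ∃ G, G₀ ≤ G ∧ Maximal IsGraph G := by
  refine zorn_le_nonempty₀ {G | IsGraph G} (fun c hc hchain y hy => ?_) G₀ h₀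
  have hne : c.Nonempty := ⟨y, hy⟩
  refine ⟨sSup c, fun z hz => ?_, fun z hz => le_sSup hz⟩
  have := hne.to_subtype
  rw [sSup_eq_iSup', ← SetLike.mem_coe,
    Subalgebra.coe_iSup_of_directed hchain.directed, Set.mem_iUnion] at hz
  obtain ⟨G, hG⟩ := hz
  exact hc G.2 z hG

/-- The hypothesis says that adjoining `(x, c)` to `G` still gives a graph: each relation satisfied
by `x` is satisfied by `c` after specialization. -/
theorem mem_of_maximal_isGraph {G : Subalgebra k (K × k)} (hG : Maximal IsGraph G) {x : K} {c : k}
    (h : ∀ P : Polynomial G, P.eval₂ (graphFst G) x = 0 → P.eval₂ (graphSnd G) c = 0) :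
    (x, c) ∈ G := by
  let ev : Polynomial G →ₐ[k] K × k :=
    { Polynomial.eval₂RingHom G.val.toRingHom (x, c) with
      commutes' := fun z => Polynomial.eval₂_C G.val.toRingHom (x, c) }
  have hev1 : ∀ P : Polynomial G, (ev P).1 = P.eval₂ (graphFst G) x := fun P =>
    Polynomial.hom_eval₂ P G.val.toRingHom (RingHom.fst K k) (x, c)
  have hev2 : ∀ P : Polynomial G, (ev P).2 = P.eval₂ (graphSnd G) c := fun P =>
    Polynomial.hom_eval₂ P G.val.toRingHom (RingHom.snd K k) (x, c)
  have hle : G ≤ ev.range := fun g hg =>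
    ⟨Polynomial.C ⟨g, hg⟩, Polynomial.eval₂_C G.val.toRingHom (x, c)⟩
  have hG' : IsGraph ev.range := by
    rintro z ⟨P, hP⟩
    have h1 : (ev P).1 = 0 := congrArg Prod.fst hP
    have h2 : (ev P).2 = z := congrArg Prod.snd hP
    rw [← h2, hev2, h P (by rw [← hev1, h1])]
  exact hG.2 hG' hle ⟨Polynomial.X, Polynomial.eval₂_X G.val.toRingHom (x, c)⟩

theorem inv_mem_of_maximal_isGraph {G : Subalgebra k (K × k)} (hG : Maximal IsGraph G) {x : K}
    {c : k} (h : (x, c) ∈ G) (hc : c ≠ 0) : (x⁻¹, c⁻¹) ∈ G := by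
  have hx : x ≠ 0 := by
    rintro rfl
    exact hc (hG.1 c h)
  refine mem_of_maximal_isGraph hG fun P hP => ?_
  let g : G := ⟨(x, c), h⟩
  have h1 : P.reverse.eval₂ (graphFst G) x = graphFst G (P.reverse.eval g) :=
    Polynomial.eval₂_at_apply (graphFst G) g
  have h2 : P.reverse.eval₂ (graphSnd G) c = graphSnd G (P.reverse.eval g) :=
    Polynomial.eval₂_at_apply (graphSnd G) g
  let := invertibleOfNonzero (inv_ne_zero hx)
  let := invertibleOfNonzero (inv_ne_zero hc)
  rw [← Polynomial.eval₂_reverse_eq_zero_iff, invOf_eq_inv, inv_inv] at hP ⊢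
  rw [h2]
  exact hG.1.snd_eq_zero (h1.symm.trans hP)

/-- A maximal graph contains an element over each element of a local ring that dominates it. -/
theorem exists_mem_of_maximal_isGraph [IsAlgClosed k] {G : Subalgebra k (K × k)}
    (hG : Maximal IsGraph G) {F : Type*} [Field F] {x : K}
    (h : ∃ (B : Subring K) (_ : x ∈ B) (hB : ∀ g, graphFst G g ∈ B) (res : B →+* F),
      ∀ g, graphSnd G g = 0 → res ⟨_, hB g⟩ = 0) : ∃ c, (x, c) ∈ G := by
  obtain ⟨B, hxB, hB, res, hres⟩ := h
  -- The specialized relations of `x` over `G`. A common root in `k` is an admissible value for `x`.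
  let a : Ideal (Polynomial k) := (RingHom.ker (Polynomial.eval₂RingHom (graphFst G) x)).map
    (Polynomial.mapRingHom (graphSnd G))
  have ha : ∀ P : Polynomial G, P.eval₂ (graphFst G) x = 0 → P.map (graphSnd G) ∈ a :=
    fun P hP => Ideal.mem_map_of_mem (Polynomial.mapRingHom (graphSnd G)) hP
  -- Otherwise some relation of `x` specializes to the constant 1, and its image under `res` reads
  -- `1 = 0`.
  have hne : a ≠ ⊤ := by
    intro htop
    have h1 : (1 : Polynomial k) ∈ a := htop ▸ Submodule.mem_top
    rw [Ideal.mem_map_iff_of_surjective _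
      (Polynomial.map_surjective _ (graphSnd_surjective G))] at h1
    obtain ⟨P, hP, hP1⟩ := h1
    let i : G →+* B := (graphFst G).codRestrict B hB
    let ψ : G →+* F := res.comp i
    have hker : (P - 1).map ψ = 0 := by
      ext e
      rw [Polynomial.coeff_map, Polynomial.coeff_zero]
      refine hres _ ?_
      rw [← Polynomial.coeff_map, Polynomial.map_sub, Polynomial.map_one]
      have hP1' : P.map (graphSnd G) = 1 := hP1
      rw [hP1', sub_self, Polynomial.coeff_zero]
    have h0 : P.eval₂ i ⟨x, hxB⟩ = 0 := by
      apply Subtype.ext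
      have := Polynomial.hom_eval₂ P i B.subtype ⟨x, hxB⟩
      exact this.trans hP
    have h2 : P.eval₂ ψ (res ⟨x, hxB⟩) = 0 := by
      rw [← Polynomial.hom_eval₂, h0, map_zero]
    rw [← Polynomial.eval_map, ← sub_add_cancel P 1, Polynomial.map_add, hker, zero_add,
      Polynomial.map_one, Polynomial.eval_one] at h2
    exact one_ne_zero h2
  obtain ⟨f, hf⟩ : ∃ f, a = Ideal.span {f} := (IsPrincipalIdealRing.principal a).principal
  have hroot : ∃ c, f.eval c = 0 := by
    by_cases hf0 : f.degree = 0
    · exact absurd (hf.trans (Ideal.span_singleton_eq_top.mpr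
        (Polynomial.isUnit_iff_degree_eq_zero.mpr hf0))) hne
    · exact IsAlgClosed.exists_root f hf0
  obtain ⟨c, hc⟩ := hroot
  refine ⟨c, mem_of_maximal_isGraph hG fun P hP => ?_⟩
  have h1 := ha P hP
  rw [hf, Ideal.mem_span_singleton] at h1
  obtain ⟨q, hq⟩ := h1
  rw [← Polynomial.eval_map, hq, Polynomial.eval_mul, hc, zero_mul]

/-- Extension of homomorphisms to valuation rings: a homomorphism from a subalgebra of `K` to the
algebraically closed field `k` extends to a valuation ring of `K`. -/
theorem exists_valuationRing_extension [IsAlgClosed k] {G₀ : Subalgebra k (K × k)}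
    (h₀ : IsGraph G₀) :
    ∃ (R : Subring K) (ρ : R →+* k), (∀ x, x ∈ R ∨ x⁻¹ ∈ R) ∧ Function.Surjective ρ ∧
      ∀ x c, (x, c) ∈ G₀ → ∃ hx : x ∈ R, ρ ⟨x, hx⟩ = c := by
  obtain ⟨G, hle, hG⟩ := exists_maximal_isGraph h₀
  let e : G ≃+* (graphFst G).range := RingEquiv.ofBijective (graphFst G).rangeRestrict
    ⟨fun a b hab => hG.1.fst_injective (congrArg Subtype.val hab),
      (graphFst G).rangeRestrict_surjective⟩
  have hunit : ∀ g : G, graphSnd G g ≠ 0 → IsUnit g := fun g hg => by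
    refine isUnit_iff_exists_inv.mpr
      ⟨⟨_, inv_mem_of_maximal_isGraph hG (x := g.1.1) (c := g.1.2) g.2 hg⟩, ?_⟩
    refine hG.1.fst_injective ?_
    rw [map_one, map_mul]
    refine mul_inv_cancel₀ fun h => hg (hG.1.snd_eq_zero h)
  have hlocG : IsLocalRing G := by
    have : Nontrivial G := (graphSnd G).domain_nontrivial
    refine IsLocalRing.of_isUnit_or_isUnit_one_sub_self fun g => ?_
    by_cases hg : graphSnd G g = 0
    · exact Or.inr (hunit _ (by rw [map_sub, map_one, hg, sub_zero]; exact one_ne_zero))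
    · exact Or.inl (hunit g hg)
  have hloc : IsLocalRing (graphFst G).range := e.isLocalRing
  let A : LocalSubring K := { toSubring := (graphFst G).range, isLocalRing := hloc }
  have hmax : IsMax A := by
    intro B hB
    have hBA : B.toSubring ≤ A.toSubring := by
      intro x hx
      have : ∃ c, (x, c) ∈ G := by
        -- `B` dominates `A`: an element specializing to 0 is not a unit of `A`, hence not a unit of
        -- `B`, so the residue map of `B` kills it.
        refine exists_mem_of_maximal_isGraph hG (F := IsLocalRing.ResidueField B.toSubring)
          ⟨B.toSubring, hx, fun g => hB.1 ⟨g, rfl⟩, IsLocalRing.residue _, fun g hg => ?_⟩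
        rw [IsLocalRing.residue_eq_zero_iff, IsLocalRing.mem_maximalIdeal]
        intro hu
        have hu' : IsUnit (e g) := hB.2.1 (e g) hu
        have hg' : IsUnit g := (MulEquiv.isUnit_map e).mp hu'
        exact (hg'.map (graphSnd G)).ne_zero hg
      obtain ⟨c, hc⟩ := this
      exact ⟨⟨(x, c), hc⟩, rfl⟩
    have : B = A := LocalSubring.toSubring_injective (le_antisymm hBA hB.1)
    exact this.le
  obtain ⟨V, hV⟩ := LocalSubring.exists_valuationRing_of_isMax hmax
  have hVR : V.toSubring = (graphFst G).range := congrArg LocalSubring.toSubring hV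
  refine ⟨(graphFst G).range, (graphSnd G).comp e.symm.toRingHom, fun x => ?_,
    (graphSnd_surjective G).comp e.symm.surjective, fun x c hxc => ?_⟩
  · rw [← hVR]
    exact V.mem_or_inv_mem x
  · refine ⟨⟨⟨(x, c), hle hxc⟩, rfl⟩, ?_⟩
    have : e.symm ⟨x, ⟨⟨(x, c), hle hxc⟩, rfl⟩⟩ = ⟨(x, c), hle hxc⟩ :=
      e.symm_apply_eq.mpr (Subtype.ext rfl)
    change graphSnd G (e.symm _) = c
    rw [this]
    rfl

end Place
-- Reduction of homogeneous ideals along a valuation ring.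
section Reduction

variable {σ k K : Type*} [Field k] [Field K]

theorem map_homogeneousComponent {R S : Type*} [CommSemiring R] [CommSemiring S] (f : R →+* S)
    (D : ℕ) (P : MvPolynomial σ R) :
    map f (homogeneousComponent D P) = homogeneousComponent D (map f P) := by
  classical
  ext m
  rw [coeff_map, coeff_homogeneousComponent, coeff_homogeneousComponent, coeff_map]
  split_ifs <;> simp

/-- In a finite family in the fraction field of a valuation ring, some nonzero member divides all
the others. -/
theorem exists_forall_div_mem {R : Subring K} (hR : ∀ x, x ∈ R ∨ x⁻¹ ∈ R) {ι : Type*} [Fintype ι]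
    {c : ι → K} (hc : c ≠ 0) : ∃ i, c i ≠ 0 ∧ ∀ j, c j / c i ∈ R := by
  let V : ValuationSubring K := { R with mem_or_inv_mem' := hR }
  obtain ⟨i₀, hi₀⟩ := Function.ne_iff.mp hc
  obtain ⟨i, -, hi⟩ := Finset.exists_max_image Finset.univ (fun j => V.valuation (c j))
    ⟨i₀, Finset.mem_univ i₀⟩
  have hci : c i ≠ 0 := by
    intro h0
    have := hi i₀ (Finset.mem_univ _)
    rw [h0, map_zero, le_zero_iff, map_eq_zero] at this
    exact hi₀ this
  refine ⟨i, hci, fun j => ?_⟩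
  have h1 : V.valuation (c j / c i) ≤ 1 := by
    rw [map_div₀]
    exact div_le_one_of_le₀ (hi j (Finset.mem_univ _)) zero_le
  exact (V.valuation_le_one_iff _).mp h1

variable {R : Subring K} (ρ : R →+* k)

/-- The reduction of an ideal over `K` along `K ⊇ R → k`. -/
def reduction (I : Ideal (MvPolynomial σ K)) : Ideal (MvPolynomial σ k) :=
  (I.comap (map R.subtype)).map (map ρ)

variable {ρ}

theorem mem_reduction_iff (hρ : Function.Surjective ρ) {I : Ideal (MvPolynomial σ K)}
    {f : MvPolynomial σ k} :
    f ∈ reduction ρ I ↔ ∃ P : MvPolynomial σ R, map R.subtype P ∈ I ∧ map ρ P = f :=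
  Ideal.mem_map_iff_of_surjective _ (map_surjective ρ hρ)

theorem reduction_bot : reduction (σ := σ) ρ ⊥ = ⊥ := by
  rw [reduction, eq_bot_iff, Ideal.map_le_iff_le_comap]
  intro P hP
  have h0 : P = 0 := map_injective R.subtype Subtype.val_injective (by
    rw [map_zero]; exact hP)
  rw [h0]
  exact Ideal.zero_mem _

theorem isHomogeneousIdeal_reduction (hρ : Function.Surjective ρ) {I : Ideal (MvPolynomial σ K)}
    (hI : IsHomogeneousIdeal I) : IsHomogeneousIdeal (reduction ρ I) := by
  intro f hf D
  obtain ⟨P, hP, rfl⟩ := (mem_reduction_iff hρ).mp hf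
  refine (mem_reduction_iff hρ).mpr ⟨homogeneousComponent D P, ?_, map_homogeneousComponent _ _ _⟩
  rw [map_homogeneousComponent]
  exact hI _ hP D

/-- Polynomials that are independent modulo the reduction of `I` are independent modulo `I`. -/
theorem eq_zero_of_sum_mem (hR : ∀ x, x ∈ R ∨ x⁻¹ ∈ R) (hρ : Function.Surjective ρ)
    {I : Ideal (MvPolynomial σ K)} {ι : Type*} [Fintype ι] {P : ι → MvPolynomial σ R}
    (h : ∀ c : ι → k, ∑ j, C (c j) * map ρ (P j) ∈ reduction ρ I → c = 0) {c : ι → K}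
    (hc : ∑ j, C (c j) * map R.subtype (P j) ∈ I) : c = 0 := by
  by_contra hc0
  -- After division by a coefficient of largest valuation, all coefficients lie in `R` and one
  -- equals 1, so the relation reduces to a nontrivial one.
  obtain ⟨i, hi, hdiv⟩ := exists_forall_div_mem hR hc0
  have h1 : (fun j => ρ ⟨c j / c i, hdiv j⟩) = 0 := by
    refine h _ ((mem_reduction_iff hρ).mpr ⟨∑ j, C ⟨c j / c i, hdiv j⟩ * P j, ?_, ?_⟩)
    · have h2 : map R.subtype (∑ j, C ⟨c j / c i, hdiv j⟩ * P j) =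
          C (c i)⁻¹ * ∑ j, C (c j) * map R.subtype (P j) := by
        rw [map_sum, Finset.mul_sum]
        refine Finset.sum_congr rfl fun j _ => ?_
        have h3 : R.subtype ⟨c j / c i, hdiv j⟩ = (c i)⁻¹ * c j := div_eq_inv_mul _ _
        rw [map_mul, map_C, ← mul_assoc, ← C_mul, h3]
      rw [h2]
      exact I.mul_mem_left _ hc
    · simp only [map_sum, map_mul, map_C]
  have h3 := congrFun h1 i
  have h4 : (⟨c i / c i, hdiv i⟩ : R) = 1 := Subtype.ext (div_self hi)
  simp only [h4, map_one, Pi.zero_apply, one_ne_zero] at h3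

theorem exists_map_eq_of_isHomogeneous (hρ : Function.Surjective ρ) {f : MvPolynomial σ k} {D : ℕ}
    (hf : f.IsHomogeneous D) :
    ∃ P : MvPolynomial σ R, P.IsHomogeneous D ∧ map ρ P = f := by
  obtain ⟨P, rfl⟩ := map_surjective ρ hρ f
  exact ⟨homogeneousComponent D P, homogeneousComponent_isHomogeneous D P, by
    rw [map_homogeneousComponent, homogeneousComponent_eq_self hf]⟩

theorem hilb_reduction_le [Finite σ] (hR : ∀ x, x ∈ R ∨ x⁻¹ ∈ R) (hρ : Function.Surjective ρ)
    (I : Ideal (MvPolynomial σ K)) (D : ℕ) : hilb (reduction ρ I) D ≤ hilb I D := by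
  let b : Module.Basis (Fin (hilb (reduction ρ I) D)) k
      (homogeneousSubmodule σ k D ⧸ gradedPart (reduction ρ I) D) := Module.finBasis k _
  choose u hu using fun j => Submodule.mkQ_surjective (gradedPart (reduction ρ I) D) (b j)
  choose P hPD hP using fun j => exists_map_eq_of_isHomogeneous hρ (u j).2
  let v : Fin (hilb (reduction ρ I) D) → homogeneousSubmodule σ K D :=
    fun j => ⟨map R.subtype (P j), (hPD j).map _⟩
  have hli : LinearIndependent K fun j => (gradedPart I D).mkQ (v j) := by
    rw [Fintype.linearIndependent_iff]
    intro c hc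
    refine congrFun (eq_zero_of_sum_mem hR hρ (I := I) (P := P) (fun c hc => ?_) ?_)
    · funext j
      refine Fintype.linearIndependent_iff.mp b.linearIndependent c ?_ j
      simp only [← hu, ← map_smul]
      rw [← map_sum, Submodule.mkQ_apply, Submodule.Quotient.mk_eq_zero, mem_gradedPart]
      convert hc using 1
      simp [hP, smul_eq_C_mul]
    · simp only [← map_smul] at hc
      rw [← map_sum, Submodule.mkQ_apply, Submodule.Quotient.mk_eq_zero, mem_gradedPart] at hc
      convert hc using 1
      simp [v, smul_eq_C_mul]
  have := hli.fintype_card_le_finrank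
  rwa [Fintype.card_fin] at this

theorem exists_linearIndependent_mem {V : Type*} [AddCommGroup V] [Module k V]
    [FiniteDimensional k V] (W : Submodule k V) :
    ∃ b : Fin (Module.finrank k W) → V, (∀ j, b j ∈ W) ∧ LinearIndependent k b :=
  ⟨fun j => (Module.finBasis k W j : V), fun j => (Module.finBasis k W j).2,
    (Module.finBasis k W).linearIndependent.map' W.subtype W.ker_subtype⟩

theorem le_finrank_of_linearIndependent {V : Type*} [AddCommGroup V] [Module k V]
    [FiniteDimensional k V] {W : Submodule k V} {s : ℕ} {v : Fin s → V}
    (hv : LinearIndependent k v) (hW : ∀ j, v j ∈ W) : s ≤ Module.finrank k W := by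
  have h := Submodule.finrank_mono (Submodule.span_le.mpr (Set.range_subset_iff.mpr hW))
  rwa [finrank_span_eq_card hv, Fintype.card_fin] at h

/-- Independent forms of the reduced ideal lift to forms of `I`. The lifts are independent by
`eq_zero_of_sum_mem` for the zero ideal. -/
theorem finrank_gradedPart_reduction_le [Finite σ] (hR : ∀ x, x ∈ R ∨ x⁻¹ ∈ R)
    (hρ : Function.Surjective ρ) {I : Ideal (MvPolynomial σ K)} (hI : IsHomogeneousIdeal I)
    (D : ℕ) : Module.finrank k (gradedPart (reduction ρ I) D) ≤
      Module.finrank K (gradedPart I D) := by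
  obtain ⟨b, hbmem, hb⟩ := exists_linearIndependent_mem (gradedPart (reduction ρ I) D)
  have hex : ∀ j, ∃ P : MvPolynomial σ R, P.IsHomogeneous D ∧ map R.subtype P ∈ I ∧
      map ρ P = (b j : MvPolynomial σ k) := fun j => by
    obtain ⟨P, hP, hPb⟩ := (mem_reduction_iff hρ).mp (mem_gradedPart.mp (hbmem j))
    refine ⟨homogeneousComponent D P, homogeneousComponent_isHomogeneous D P, ?_, ?_⟩
    · rw [map_homogeneousComponent]
      exact hI _ hP D
    · rw [map_homogeneousComponent, hPb]
      exact homogeneousComponent_eq_self (b j).2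
  choose P hPD hPI hP using hex
  let v : Fin (Module.finrank k (gradedPart (reduction ρ I) D)) → homogeneousSubmodule σ K D :=
    fun j => ⟨map R.subtype (P j), (hPD j).map _⟩
  have hli : LinearIndependent K v := by
    rw [Fintype.linearIndependent_iff]
    intro c hc
    refine congrFun (eq_zero_of_sum_mem hR hρ (I := ⊥) (P := P) (fun c hc => ?_) ?_)
    · funext j
      refine Fintype.linearIndependent_iff.mp hb c ?_ j
      rw [reduction_bot, Ideal.mem_bot] at hc
      apply Subtype.ext
      simpa [hP, smul_eq_C_mul] using hc
    · rw [Ideal.mem_bot]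
      have := congrArg (fun z : homogeneousSubmodule σ K D => (z : MvPolynomial σ K)) hc
      simpa [v, smul_eq_C_mul] using this
  exact le_finrank_of_linearIndependent hli hPI

/-- The coefficients of forms of degree `D`. -/
def formCoeff (n D : ℕ) (k : Type*) [Field k] :
    homogeneousSubmodule (Fin (n + 1)) k D →ₗ[k] (Mon n D → k) :=
  LinearMap.pi fun m => lcoeff k m.1 ∘ₗ (homogeneousSubmodule (Fin (n + 1)) k D).subtype

theorem formCoeff_bijective (n D : ℕ) (k : Type*) [Field k] :
    Function.Bijective (formCoeff n D k) := by
  constructor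
  · intro f g hfg
    apply Subtype.ext
    rw [← formOfCoeff_coeff f.2, ← formOfCoeff_coeff g.2]
    exact congrArg formOfCoeff hfg
  · intro a
    refine ⟨⟨formOfCoeff (d := D) a, isHomogeneous_formOfCoeff (d := D) a⟩, ?_⟩
    funext m
    exact coeff_formOfCoeff (d := D) a m

theorem finrank_homogeneousSubmodule (n D : ℕ) (k : Type*) [Field k] :
    Module.finrank k (homogeneousSubmodule (Fin (n + 1)) k D) = Fintype.card (Mon n D) := by
  rw [(LinearEquiv.ofBijective _ (formCoeff_bijective n D k)).finrank_eq,
    Module.finrank_fintype_fun_eq_card]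

/-- The limit is flat: neither the quotient nor the ideal gains dimension under reduction, and the
space of all forms has the same dimension over both fields. -/
theorem hilb_reduction {n : ℕ} (hR : ∀ x, x ∈ R ∨ x⁻¹ ∈ R) (hρ : Function.Surjective ρ)
    {I : Ideal (MvPolynomial (Fin (n + 1)) K)} (hI : IsHomogeneousIdeal I) (D : ℕ) :
    hilb (reduction ρ I) D = hilb I D := by
  refine le_antisymm (hilb_reduction_le hR hρ I D) ?_
  have h1 := hilb_add_finrank I D
  have h2 := hilb_add_finrank (reduction ρ I) D
  have h3 := finrank_gradedPart_reduction_le hR hρ hI D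
  rw [finrank_homogeneousSubmodule] at h1 h2
  omega

end Reduction

/-! ### Ideals of finite families of points. -/

section Points

variable {σ K : Type*} [Field K] {r : ℕ}

/-- The homogeneous ideal of a family of points of projective space. -/
def pointsIdeal (x : Fin r → σ → K) : Ideal (MvPolynomial σ K) :=
  ⨅ i, RingHom.ker (aeval (R := K) fun j => Polynomial.C (x i j) * Polynomial.X)

theorem aeval_C_mul_X_of_isHomogeneous {f : MvPolynomial σ K} {D : ℕ} (hf : f.IsHomogeneous D)
    (x : σ → K) : aeval (R := K) (fun j => Polynomial.C (x j) * Polynomial.X) f =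
      Polynomial.C (eval x f) * Polynomial.X ^ D := by
  rw [aeval_def, eval₂_eq, eval_eq, map_sum, Finset.sum_mul]
  refine Finset.sum_congr rfl fun m hm => ?_
  have hm' : ∑ i ∈ m.support, m i = D := (hf.degree_eq_sum_deg_support hm).symm
  simp only [mul_pow, Finset.prod_mul_distrib, Finset.prod_pow_eq_pow_sum, hm', map_mul, map_prod,
    map_pow, Polynomial.algebraMap_eq, mul_assoc]

/-- On the line through `x i` with parameter `T`, the coefficient of `T ^ D` in the restriction of
`f` is the value at `x i` of its component of degree `D`. -/
theorem mem_pointsIdeal_iff {x : Fin r → σ → K} {f : MvPolynomial σ K} :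
    f ∈ pointsIdeal x ↔ ∀ i D, eval (x i) (homogeneousComponent D f) = 0 := by
  rw [pointsIdeal, Submodule.mem_iInf]
  refine forall_congr' fun i => ?_
  rw [RingHom.mem_ker]
  have hcoeff : ∀ D, (aeval (R := K) (fun j => Polynomial.C (x i j) * Polynomial.X) f).coeff D =
      eval (x i) (homogeneousComponent D f) := by
    intro D
    conv_lhs => rw [← sum_homogeneousComponent f]
    rw [map_sum, Polynomial.finsetSum_coeff]
    simp only [aeval_C_mul_X_of_isHomogeneous (homogeneousComponent_isHomogeneous _ f),
      Polynomial.coeff_C_mul_X_pow]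
    rw [Finset.sum_ite_eq]
    split_ifs with hD
    · rfl
    · rw [homogeneousComponent_eq_zero, map_zero]
      simpa using hD
  constructor
  · intro h D
    rw [← hcoeff, h, Polynomial.coeff_zero]
  · intro h
    ext D
    rw [hcoeff, h D, Polynomial.coeff_zero]

theorem isHomogeneousIdeal_pointsIdeal (x : Fin r → σ → K) :
    IsHomogeneousIdeal (pointsIdeal x) := by
  intro f hf D
  rw [mem_pointsIdeal_iff] at hf ⊢
  intro i E
  rw [homogeneousComponent_of_mem (homogeneousComponent_isHomogeneous D f)]
  split_ifs
  · exact hf i D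
  · exact map_zero _

theorem isSaturatedIdeal_pointsIdeal {x : Fin r → σ → K} (hx : ∀ i, x i ≠ 0) :
    IsSaturatedIdeal (pointsIdeal x) := by
  rintro f ⟨N, hN⟩
  rw [pointsIdeal, Submodule.mem_iInf]
  intro i
  obtain ⟨j, hj⟩ := Function.ne_iff.mp (hx i)
  have h1 := (Submodule.mem_iInf _).mp (hN j) i
  rw [RingHom.mem_ker, map_mul, map_pow, aeval_X, mul_eq_zero] at h1
  refine h1.resolve_left (pow_ne_zero _ (mul_ne_zero ?_ Polynomial.X_ne_zero))
  exact Polynomial.C_ne_zero.mpr hj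

theorem hilb_pointsIdeal_le [Finite σ] (x : Fin r → σ → K) (D : ℕ) :
    hilb (pointsIdeal x) D ≤ r := by
  let φ : homogeneousSubmodule σ K D →ₗ[K] Fin r → K :=
    LinearMap.pi fun i => (aeval (R := K) (x i)).toLinearMap ∘ₗ
      (homogeneousSubmodule σ K D).subtype
  have hker : gradedPart (pointsIdeal x) D = LinearMap.ker φ := by
    ext f
    rw [mem_gradedPart, mem_pointsIdeal_iff, LinearMap.mem_ker, funext_iff]
    refine forall_congr' fun i => ?_
    have hφ : φ f i = eval (x i) f.1 := by simp [φ]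
    rw [hφ]
    constructor
    · intro h
      have := h D
      rwa [homogeneousComponent_eq_self f.2] at this
    · intro h E
      rw [homogeneousComponent_of_mem f.2]
      split_ifs
      · exact h
      · exact map_zero _
  rw [hilb, hker, φ.quotKerEquivRange.finrank_eq]
  refine (Submodule.finrank_le _).trans ?_
  simp

end Points

/-! ### Limits of generic points, and existence. -/

section Existence

variable {n : ℕ}

/-- The coordinates of `r` points of the affine cone of `ℙⁿ`, and `r` scalars. -/
abbrev SecantParam (n r : ℕ) : Type := (Fin r × Fin (n + 1)) ⊕ Fin r

/-- The general linear combination of `r` Veronese vectors, over a commutative `ℂ`-algebra. -/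
def secantPoint (r d : ℕ) {A : Type*} [CommRing A] (t : SecantParam n r → A) (m : Mon n d) : A :=
  ∑ i, t (Sum.inr i) * ∏ j, t (Sum.inl (i, j)) ^ m.1 j

theorem map_secantPoint (r d : ℕ) {A B : Type*} [CommRing A] [CommRing B] (f : A →+* B)
    (t : SecantParam n r → A) (m : Mon n d) :
    f (secantPoint r d t m) = secantPoint r d (fun a => f (t a)) m := by
  simp only [secantPoint, map_sum, map_mul, map_prod, map_pow]

/-- If a polynomial vanishes on a line through the origin, so do its homogeneous components. -/
theorem eval_homogeneousComponent_eq_zero {ι : Type*} {F : MvPolynomial ι ℂ} {w : ι → ℂ}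
    (h : ∀ z : ℂ, eval (z • w) F = 0) (e : ℕ) : eval w (homogeneousComponent e F) = 0 := by
  let P : Polynomial ℂ := ∑ e ∈ Finset.range (F.totalDegree + 1),
    Polynomial.C (eval w (homogeneousComponent e F)) * Polynomial.X ^ e
  have hP : P = 0 := by
    refine Polynomial.funext fun z => ?_
    rw [Polynomial.eval_zero, ← h z]
    conv_rhs => rw [← sum_homogeneousComponent F, map_sum]
    rw [Polynomial.eval_finsetSum]
    refine Finset.sum_congr rfl fun e _ => ?_
    rw [eval_smul_of_isHomogeneous (homogeneousComponent_isHomogeneous e F)]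
    rw [Polynomial.eval_mul, Polynomial.eval_C, Polynomial.eval_pow, Polynomial.eval_X, mul_comm]
  by_cases he : e ∈ Finset.range (F.totalDegree + 1)
  · have h1 := congrArg (fun Q => Polynomial.coeff Q e) hP
    simp only [P, Polynomial.finsetSum_coeff, Polynomial.coeff_C_mul_X_pow,
      Polynomial.coeff_zero, Finset.sum_ite_eq, if_pos he] at h1
    exact h1
  · rw [homogeneousComponent_eq_zero, map_zero]
    simpa using he

/-- A polynomial that vanishes at the generic point of the secant variety vanishes on it. -/
theorem eval_rep_eq_zero_of_mem_secantVariety {r d : ℕ} {p : ℙ ℂ (SymPow n d)}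
    (hp : p ∈ secantVariety r (Set.range (veronese (n := n) d))) {F : MvPolynomial (Mon n d) ℂ}
    (hF : aeval (secantPoint r d (X : SecantParam n r → MvPolynomial (SecantParam n r) ℂ)) F = 0) :
    eval p.rep F = 0 := by
  have hvan : ∀ t : SecantParam n r → ℂ, eval (secantPoint r d t) F = 0 := by
    intro t
    have h1 := congrArg (aeval t) hF
    rw [map_zero, ← AlgHom.comp_apply, comp_aeval] at h1
    have h2 : (fun m => aeval t (secantPoint r d
        (X : SecantParam n r → MvPolynomial (SecantParam n r) ℂ) m)) =
        (secantPoint r d t : Mon n d → ℂ) := by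
      funext m
      have h3 := map_secantPoint r d (aeval (R := ℂ) t).toRingHom X m
      refine h3.trans ?_
      congr 1
      funext a
      exact aeval_X t a
    rw [h2] at h1
    exact h1
  rw [← sum_homogeneousComponent F, map_sum]
  refine Finset.sum_eq_zero fun e _ => hp e _ (homogeneousComponent_isHomogeneous e F) ?_
  rintro a ⟨y, hy, ha⟩
  obtain ⟨x, c, hxc⟩ := exists_rep_eq_sum hy ha
  rw [hxc]
  refine eval_homogeneousComponent_eq_zero (fun z => ?_) e
  -- Scaling the coefficients `c` by `z` stays in the parametrized family, so `F` vanishes on the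
  -- whole line and each component vanishes.
  have h1 := hvan (Sum.elim (fun a => x a.1 a.2) fun i => z * c i)
  convert h1 using 3
  funext m
  simp [secantPoint, veroneseVec, Finset.mul_sum, mul_assoc]

/-- Every point of the `r`-th secant variety of the Veronese variety lies in the span of a
zero-dimensional subscheme of degree at most `r`. -/
theorem exists_mem_perp_of_mem_secantVariety {r d : ℕ} (hd : r ≤ d + 1) {p : ℙ ℂ (SymPow n d)}
    (hp : p ∈ secantVariety r (Set.range (veronese (n := n) d))) :
    ∃ s ≤ r, ∃ Z : ProjSubscheme n, Z.IsZeroDimOfDegree s ∧ p.rep ∈ Z.perp d := by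
  let B := MvPolynomial (SecantParam n r) ℂ
  let K := FractionRing B
  let t : SecantParam n r → K := fun a => algebraMap B K (X a)
  let P : Mon n d → K := secantPoint r d t
  have hinj : Function.Injective (algebraMap B K) := IsFractionRing.injective B K
  have hPB : ∀ m, algebraMap B K (secantPoint r d X m) = P m := fun m =>
    map_secantPoint r d (algebraMap B K) X m
  let ev : MvPolynomial (Mon n d) ℂ →ₐ[ℂ] K × ℂ := (aeval P).prod (aeval p.rep)
  -- Polynomials vanishing at the generic point `P` vanish at `p`, so `P ↦ p.rep` is a well-defined
  -- specialization.
  have hgraph : IsGraph ev.range := by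
    rintro c ⟨F, hF⟩
    have h1 : aeval P F = 0 := congrArg Prod.fst hF
    have h2 : aeval p.rep F = c := congrArg Prod.snd hF
    rw [← h2]
    refine eval_rep_eq_zero_of_mem_secantVariety hp (hinj ?_)
    rw [map_zero, ← h1, ← aeval_algebraMap_apply]
    congr 2
    funext m
    exact hPB m
  obtain ⟨R, ρ, hR, hρ, hext⟩ := exists_valuationRing_extension hgraph
  let x : Fin r → Fin (n + 1) → K := fun i j => t (Sum.inl (i, j))
  have hx : ∀ i, x i ≠ 0 := fun i h => by
    have h1 : algebraMap B K (X (Sum.inl (i, 0))) = 0 := congrFun h 0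
    rw [map_eq_zero_iff _ hinj] at h1
    exact X_ne_zero _ h1
  have : Infinite K := Infinite.of_injective (algebraMap ℂ K) (algebraMap ℂ K).injective
  have hsat := isSaturatedIdeal_pointsIdeal hx
  have hhom := isHomogeneousIdeal_pointsIdeal x
  obtain ⟨s, hs, hev⟩ := exists_hilb_eq_of_le hsat (hilb_pointsIdeal_le x)
  obtain ⟨Z, hZ, hZd⟩ := exists_projSubscheme_of_hilb_eq (d := d) (s := s)
    (isHomogeneousIdeal_reduction hρ hhom)
    (fun D hD => by
      rw [hilb_reduction hR hρ hhom]
      exact hilb_eq_of_eventually_eq hsat hev (by omega)) (by omega)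
  refine ⟨s, hs, Z, hZ, fun f hf hfd => ?_⟩
  obtain ⟨Q, hQ, hQf⟩ := (mem_reduction_iff hρ).mp (hZd f hf hfd)
  have hPR : ∀ m, ∃ h : P m ∈ R, ρ ⟨P m, h⟩ = p.rep m := fun m =>
    hext _ _ ⟨X m, Prod.ext (aeval_X P m) (aeval_X p.rep m)⟩
  choose hPmem hPρ using hPR
  -- A lift of `f` vanishes at the generic points, hence pairs to zero with `P`, a combination of
  -- their Veronese vectors. Applying `ρ` then gives `pairing f p.rep = 0`.
  have hsum : ∑ m : Mon n d, coeff m.1 (map R.subtype Q) * P m = 0 := by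
    have hform := formOfCoeff_coeff (homogeneousComponent_isHomogeneous d (map R.subtype Q))
    have hvan : ∀ i, ∑ m : Mon n d, coeff m.1 (map R.subtype Q) * ∏ j, x i j ^ m.1 j = 0 := by
      intro i
      rw [← mem_pointsIdeal_iff.mp hQ i d, ← hform, eval_formOfCoeff]
      refine Finset.sum_congr rfl fun m _ => ?_
      rw [coeff_homogeneousComponent, if_pos (degree_of_mem_mon m)]
    have hrw : ∀ m : Mon n d, coeff m.1 (map R.subtype Q) * P m = ∑ i, t (Sum.inr i) *
        (coeff m.1 (map R.subtype Q) * ∏ j, x i j ^ m.1 j) := fun m => by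
      change coeff m.1 (map R.subtype Q) * ∑ i, t (Sum.inr i) * ∏ j, x i j ^ m.1 j = _
      rw [Finset.mul_sum]
      exact Finset.sum_congr rfl fun i _ => mul_left_comm (G := K) _ _ _
    rw [Finset.sum_congr rfl fun m _ => hrw m, Finset.sum_comm]
    refine Finset.sum_eq_zero fun i _ => ?_
    rw [← Finset.mul_sum, hvan i, mul_zero]
  have hsumR : ∑ m : Mon n d, coeff m.1 Q * (⟨P m, hPmem m⟩ : R) = 0 := by
    apply Subtype.ext
    rw [← Subring.subtype_apply, map_sum]
    simpa only [map_mul, coeff_map, Subring.subtype_apply, ZeroMemClass.coe_zero] using hsum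
  have h1 := congrArg ρ hsumR
  rw [map_sum, map_zero] at h1
  rw [pairing, ← hQf, ← h1]
  refine Finset.sum_congr rfl fun m _ => ?_
  rw [coeff_map, map_mul, hPρ]

/-- Under condition (B), the span of a subscheme of degree less than `r` lies in the secant variety
`σ_{r-1}`. -/
theorem mem_secantVariety_of_lt {r d : ℕ} (hB : ConditionB n r) (hd : r ≤ d + 1)
    {p : ℙ ℂ (SymPow n d)} {s : ℕ} (hs : s < r) {Z : ProjSubscheme n}
    (hZ : Z.IsZeroDimOfDegree s) (hpZ : p.rep ∈ Z.perp d) :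
    p ∈ secantVariety (r - 1) (Set.range (veronese (n := n) d)) := by
  classical
  -- Passing to a scheme of least degree supplies the Gorenstein property that condition (B)
  -- requires.
  have hex : ∃ q, ∃ Q : ProjSubscheme n, Q.IsZeroDimOfDegree q ∧ p.rep ∈ Q.perp d :=
    ⟨s, Z, hZ, hpZ⟩
  have hq : Nat.find hex ≤ s := Nat.find_min' hex ⟨Z, hZ, hpZ⟩
  obtain ⟨Q, hQ, hpQ⟩ := Nat.find_spec hex
  have hG : Q.IsGorenstein := isGorenstein_of_minimal (by omega) hQ hpQ
    fun e he W hW hpW => Nat.find_min hex he ⟨W, hW, hpW⟩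
  have hsm := hB _ (by omega) ⟨Q, hQ⟩ hG
  exact secantVariety_mono (by omega) d (mem_secantVariety_of_isSmoothable (by omega) hsm hpQ)

end Existence

end VeroneseSecant

end

theorem corollary2p19 (n r d : ℕ) (hr : 1 ≤ r) (hd : 2 * r - 1 ≤ d)
    (hB : VeroneseSecant.ConditionB n r) (p : ℙ ℂ (VeroneseSecant.SymPow n d))
    (hp : p ∈ VeroneseSecant.secantVariety r (Set.range (VeroneseSecant.veronese (n := n) d)))
    (hp' : p ∉ VeroneseSecant.secantVariety (r - 1) (Set.range (VeroneseSecant.veronese (n := n) d))) :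
    ∃! R : VeroneseSecant.Hilb n r, p ∈ R.1.veroneseSpan d := by
  obtain ⟨s, hs, Z, hZ, hpZ⟩ :=
    VeroneseSecant.exists_mem_perp_of_mem_secantVariety (by omega) hp
  have hsr : s = r := by
    by_contra hne
    exact hp' (VeroneseSecant.mem_secantVariety_of_lt hB (by omega) (by omega) hZ hpZ)
  subst hsr
  refine ⟨⟨Z, hZ⟩, (VeroneseSecant.mem_projectivization_iff_rep_mem _ p).mpr hpZ, ?_⟩
  rintro ⟨Y, hY⟩ hpY
  have hpY' := (VeroneseSecant.mem_projectivization_iff_rep_mem _ p).mp hpY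
  by_contra hne
  obtain ⟨e, he, W, hW, hpW⟩ := VeroneseSecant.exists_lt_of_mem_perp_of_ne hd hY hZ
    (fun h => hne (Subtype.ext h)) hpY' hpZ
  exact hp' (VeroneseSecant.mem_secantVariety_of_lt hB (by omega) he hW hpW)
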